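/- Let $d$ be a natural number and $\tfrac12\le\theta<1$. Let $\mathcal S_\theta(\mathbb R^d)$ be the Gelfand–Shilov space of all $f\in C^\infty(\mathbb R^d)$ such that, for some $C>0$, $$\|f\|_C:=\sup_{\alpha,\beta\in\mathbb N^d}\sup_{x\in\mathbb R^d}C^{-|\alpha|-|\beta|}(\alpha!)^{-\theta}(\beta!)^{-\theta}\,|x^\alpha\partial^\beta f(x)|<\infty ,$$ and let $\mathcal S'_\theta(\mathbb R^d)$ be its dual, i.e. the space of all linear forms $u:\mathcal S_\theta(\mathbb R^d)\to\mathbb C$ such that for every $\varepsilon>0$ there is $C_\varepsilon>0$ with $|u(f)|\le C_\varepsilon\|f\|_\varepsilon$ for all $f\in\mathcal S_\theta(\mathbb R^d)$ (the right-hand side may be $+\infty$). An FBI phase is a quadratic form $\varphi(z,y)=\tfrac12\langle Az,z\rangle+\langle Bz,y\rangle+\tfrac12\langle Cy,y\rangle$ on $\mathbb C^d\times\mathbb R^d$, where $\langle\cdot,\cdot\rangle$ is bilinear, $A,B,C$ are complex $d\times d$ matrices, $A$ and $C$ are symmetric, $\det B\ne0$, and $\operatorname{Im}C$ is positive definite.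 Put $\Phi(z)=\max_{y\in\mathbb R^d}(-\operatorname{Im}\varphi(z,y))$ and $$T_\varphi u(z)=c_\varphi\,\langle u_y,e^{i\varphi(z,y)}\rangle,\qquad c_\varphi=2^{-d/2}\pi^{-3d/4}(\det\operatorname{Im}C)^{-1/4}|\det B|,\qquad u\in\mathcal S'_\theta(\mathbb R^d),\ z\in\mathbb C^d .$$ For $(x,\xi)\in\mathbb R^{2d}$ let $\chi^b_\varphi(x,\xi)=-B^{-1}(\xi+Cx)$, the unique $z\in\mathbb C^d$ with $\varphi'_y(z,x)=-\xi$. A set is called conic if it is invariant under multiplication by positive real numbers. For $u\in\mathcal S'_\theta(\mathbb R^d)$ the global wave front set $\mathrm{WF}^\theta_{\mathrm{gl}}(u)\subset\mathbb R^{2d}\setminus\{0\}$, computed with the phase $\varphi$, is defined as follows: a point $(x_0,\xi_0)\ne0$ is not in $\mathrm{WF}^\theta_{\mathrm{gl}}(u)$ if and only if there are an open conic set $L\subset\mathbb C^d\setminus\{0\}$ containing $\chi^b_\varphi(x_0,\xi_0)$ and constants $\varepsilon,K>0$ with $$|T_\varphi u(z)|\le K\,e^{-\varepsilon|z|^{1/\theta}+\Phi(z)}\qquad\text{for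 all }z\in L .$$ **Proposition.** Let $\Gamma\subset\mathbb R^{2d}\setminus\{0\}$ be conic and closed in $\mathbb R^{2d}\setminus\{0\}$. Then there exists $u\in\mathcal S'_\theta(\mathbb R^d)$ such that $\mathrm{WF}^\theta_{\mathrm{gl}}(u)=\Gamma$, whichever FBI phase $\varphi$ is used to compute the wave front set. -/

import Mathlib

open scoped ENNReal NNReal ContDiff Matrix

noncomputable section

namespace GelfandShilov

/-! ### Gelfand-Shilov spaces -/

/-- The Euclidean space `ℝ^d`. -/
abbrev RSpace (d : ℕ) := EuclideanSpace ℝ (Fin d)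

/-- The Hermitian space `ℂ^d`. -/
abbrev CSpace (d : ℕ) := EuclideanSpace ℂ (Fin d)

/-- The length `|α| = α₁ + ⋯ + α_d` of a multi-index. -/
def mdeg {d : ℕ} (α : Fin d → ℕ) : ℕ := ∑ i, α i

/-- The factorial `α! = α₁! ⋯ α_d!` of a multi-index, as a real number. -/
def mfact {d : ℕ} (α : Fin d → ℕ) : ℝ := ∏ i, ((α i).factorial : ℝ)

/-- The monomial `x^α = x₁^{α₁} ⋯ x_d^{α_d}`. -/
def monom {d : ℕ} (α : Fin d → ℕ) (x : RSpace d) : ℝ := ∏ i, x i ^ α i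

/-- The first order partial derivative `∂_i f`. -/
def pderiv {d : ℕ} (i : Fin d) (f : RSpace d → ℂ) : RSpace d → ℂ :=
  fun x => fderiv ℝ f x (EuclideanSpace.single i 1)

/-- The partial derivative `∂^β f = ∂₁^{β₁} ⋯ ∂_d^{β_d} f`. -/
def partialDeriv {d : ℕ} (β : Fin d → ℕ) (f : RSpace d → ℂ) : RSpace d → ℂ :=
  (List.finRange d).foldr (fun i g => (pderiv i)^[β i] g) f

/-- The norm
`sup_{α, β} sup_x C^{-|α|-|β|} (α!)^{-θ} (β!)^{-θ} |x^α ∂^β f(x)|`, with values in `[0, ∞]`. -/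
def gsNorm {d : ℕ} (θ C : ℝ) (f : RSpace d → ℂ) : ℝ≥0∞ :=
  ⨆ (α : Fin d → ℕ) (β : Fin d → ℕ) (x : RSpace d),
    ENNReal.ofReal (‖(monom α x : ℂ) * partialDeriv β f x‖ /
      (C ^ (mdeg α + mdeg β) * mfact α ^ θ * mfact β ^ θ))

theorem mfact_one_le {d : ℕ} (α : Fin d → ℕ) : 1 ≤ mfact α := by
  have h : 0 < ∏ i, (α i).factorial := Finset.prod_pos fun i _ => Nat.factorial_pos _
  unfold mfact
  exact_mod_cast h

theorem gsNorm_le_iff {d : ℕ} {θ C : ℝ} (hC : 0 < C) {f : RSpace d → ℂ} {M : ℝ} (hM : 0 ≤ M) :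
    gsNorm θ C f ≤ ENNReal.ofReal M ↔ ∀ α β x, ‖(monom α x : ℂ) * partialDeriv β f x‖ ≤
      M * (C ^ (mdeg α + mdeg β) * mfact α ^ θ * mfact β ^ θ) := by
  unfold gsNorm
  simp only [iSup_le_iff]
  refine forall₃_congr fun α β x => ?_
  have h1 := mfact_one_le α
  have h2 := mfact_one_le β
  rw [ENNReal.ofReal_le_ofReal_iff hM, div_le_iff₀ (by positivity)]

theorem gsNorm_lt_top_iff {d : ℕ} {θ C : ℝ} (hC : 0 < C) {f : RSpace d → ℂ} :
    gsNorm θ C f < ⊤ ↔ ∃ M : ℝ, 0 ≤ M ∧ ∀ α β x, ‖(monom α x : ℂ) * partialDeriv β f x‖ ≤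
      M * (C ^ (mdeg α + mdeg β) * mfact α ^ θ * mfact β ^ θ) := by
  constructor
  · intro h
    refine ⟨(gsNorm θ C f).toReal, ENNReal.toReal_nonneg, ?_⟩
    rw [← gsNorm_le_iff hC ENNReal.toReal_nonneg, ENNReal.ofReal_toReal h.ne]
  · rintro ⟨M, hM, h⟩
    exact ((gsNorm_le_iff hC hM).2 h).trans_lt ENNReal.ofReal_lt_top

theorem contDiff_pderiv {d : ℕ} (i : Fin d) {f : RSpace d → ℂ} (hf : ContDiff ℝ ∞ f) :
    ContDiff ℝ ∞ (pderiv i f) := by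
  have h : ContDiff ℝ ∞ (fderiv ℝ f) := hf.fderiv_right (by simp)
  exact h.clm_apply contDiff_const

theorem exists_list {d : ℕ} (β : Fin d → ℕ) : ∃ L : List (Fin d), L.length = mdeg β ∧
    ∀ f : RSpace d → ℂ, partialDeriv β f = L.foldr pderiv f := by
  have key : ∀ l : List (Fin d), ∃ L : List (Fin d), L.length = (l.map β).sum ∧
      ∀ f : RSpace d → ℂ, l.foldr (fun i g => (pderiv i)^[β i] g) f = L.foldr pderiv f := by
    intro l
    induction l with
    | nil => exact ⟨[], rfl, fun f => rfl⟩
    | cons i l ih =>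
      obtain ⟨L, hL, h⟩ := ih
      refine ⟨List.replicate (β i) i ++ L, by simp [hL], fun f => ?_⟩
      rw [List.foldr_cons, h, List.foldr_append]
      generalize L.foldr pderiv f = g
      induction β i with
      | zero => rfl
      | succ n ihn => rw [Function.iterate_succ_apply', ihn, List.replicate_succ, List.foldr_cons]
  obtain ⟨L, hL, h⟩ := key (List.finRange d)
  refine ⟨L, ?_, h⟩
  rw [hL, mdeg, ← List.ofFn_eq_map, List.sum_ofFn]

theorem contDiff_foldr {d : ℕ} (L : List (Fin d)) {f : RSpace d → ℂ} (hf : ContDiff ℝ ∞ f) :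
    ContDiff ℝ ∞ (L.foldr pderiv f) := by
  induction L with
  | nil => exact hf
  | cons i L ih => exact contDiff_pderiv i ih

theorem partialDeriv_add {d : ℕ} (β : Fin d → ℕ) {f g : RSpace d → ℂ} (hf : ContDiff ℝ ∞ f)
    (hg : ContDiff ℝ ∞ g) : partialDeriv β (f + g) = partialDeriv β f + partialDeriv β g := by
  obtain ⟨L, -, h⟩ := exists_list β
  simp only [h]
  clear h
  induction L with
  | nil => rfl
  | cons i L ih =>
    rw [List.foldr_cons, ih]
    ext x
    have h1 := ((contDiff_foldr L hf).differentiable (by simp)).differentiableAt (x := x)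
    have h2 := ((contDiff_foldr L hg).differentiable (by simp)).differentiableAt (x := x)
    simp [pderiv, fderiv_add h1 h2]

theorem partialDeriv_smul {d : ℕ} (β : Fin d → ℕ) (c : ℂ) {f : RSpace d → ℂ}
    (hf : ContDiff ℝ ∞ f) : partialDeriv β (c • f) = c • partialDeriv β f := by
  obtain ⟨L, -, h⟩ := exists_list β
  simp only [h]
  clear h
  induction L with
  | nil => rfl
  | cons i L ih =>
    rw [List.foldr_cons, ih]
    ext x
    have h1 := ((contDiff_foldr L hf).differentiable (by simp)).differentiableAt (x := x)
    simp [pderiv, fderiv_const_smul h1 c]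

/-- The space `S_θ(ℝ^d) = S^θ_θ(ℝ^d)`: the smooth functions `f` for which
`sup_{α, β, x} C^{-|α|-|β|} (α!)^{-θ} (β!)^{-θ} |x^α ∂^β f(x)|` is finite for some `C > 0`. -/
def GS (θ : ℝ) (d : ℕ) : Submodule ℂ (RSpace d → ℂ) where
  carrier := {f | ContDiff ℝ ∞ f ∧ ∃ C : ℝ, 0 < C ∧ gsNorm θ C f < ⊤}
  zero_mem' := by
    refine ⟨contDiff_const, 1, one_pos, (gsNorm_lt_top_iff one_pos).2 ⟨0, le_rfl, ?_⟩⟩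
    intro α β x
    have h := partialDeriv_smul β 0 (contDiff_const (c := (0 : ℂ)) : ContDiff ℝ ∞ fun _ => _)
    have h' : partialDeriv β (0 : RSpace d → ℂ) = 0 := by
      rw [zero_smul, zero_smul] at h
      exact h
    simp [h']
  add_mem' := by
    rintro f g ⟨hf, C, hC, hfC⟩ ⟨hg, D, hD, hgD⟩
    obtain ⟨M, hM, hfM⟩ := (gsNorm_lt_top_iff hC).1 hfC
    obtain ⟨N, hN, hgN⟩ := (gsNorm_lt_top_iff hD).1 hgD
    have hCD : 0 < max C D := lt_max_of_lt_left hC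
    refine ⟨hf.add hg, max C D, hCD, (gsNorm_lt_top_iff hCD).2 ⟨M + N, add_nonneg hM hN, ?_⟩⟩
    intro α β x
    have h1 := mfact_one_le α
    have h2 := mfact_one_le β
    rw [partialDeriv_add β hf hg, Pi.add_apply, mul_add, add_mul]
    refine (norm_add_le _ _).trans (add_le_add ((hfM α β x).trans ?_) ((hgN α β x).trans ?_))
    · gcongr
      exact le_max_left _ _
    · gcongr
      exact le_max_right _ _
  smul_mem' := by
    rintro c f ⟨hf, C, hC, hfC⟩
    obtain ⟨M, hM, hfM⟩ := (gsNorm_lt_top_iff hC).1 hfC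
    refine ⟨contDiff_const.smul hf, C, hC,
      (gsNorm_lt_top_iff hC).2 ⟨‖c‖ * M, by positivity, ?_⟩⟩
    intro α β x
    rw [partialDeriv_smul β c hf, Pi.smul_apply, smul_eq_mul, mul_left_comm, norm_mul, mul_assoc]
    exact mul_le_mul_of_nonneg_left (hfM α β x) (norm_nonneg c)

/-- The space `S'_θ(ℝ^d)` of tempered ultradistributions: the linear forms `u` on `S_θ(ℝ^d)` such
that for every `ε > 0` there is a constant `C_ε > 0` with `|u(f)| ≤ C_ε ‖f‖_ε` for all `f`, where
`‖f‖_ε = sup_{α, β, x} ε^{-|α|-|β|} (α!)^{-θ} (β!)^{-θ} |x^α ∂^β f(x)| ∈ [0, ∞]`. -/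
structure GSDual (θ : ℝ) (d : ℕ) where
  /-- The underlying linear form. -/
  toLinearMap : GS θ d →ₗ[ℂ] ℂ
  bound : ∀ ε : ℝ, 0 < ε → ∃ C : ℝ, 0 < C ∧ ∀ f : GS θ d,
    ENNReal.ofReal ‖toLinearMap f‖ ≤ ENNReal.ofReal C * gsNorm θ ε (f : RSpace d → ℂ)

/-! ### The FBI transform -/

/-- An FBI phase: a quadratic form `½⟨Az,z⟩ + ⟨Bz,y⟩ + ½⟨Cy,y⟩` on `ℂ^d × ℝ^d` with `A`, `C`
symmetric, `det B ≠ 0` and `Im C` positive definite. -/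
structure FBIPhase (d : ℕ) where
  A : Matrix (Fin d) (Fin d) ℂ
  B : Matrix (Fin d) (Fin d) ℂ
  C : Matrix (Fin d) (Fin d) ℂ
  symm_A : A.IsSymm
  symm_C : C.IsSymm
  det_B : B.det ≠ 0
  posDef_im_C : (C.map Complex.im).PosDef

namespace FBIPhase

variable {d : ℕ} (φ : FBIPhase d)

/-- The value `φ(z, y) = ½⟨Az,z⟩ + ⟨Bz,y⟩ + ½⟨Cy,y⟩`, where `⟨·,·⟩` is bilinear. -/
def eval (z : CSpace d) (y : RSpace d) : ℂ :=
  (1 / 2) * ∑ i, ∑ j, φ.A i j * z j * z i + ∑ i, ∑ j, φ.B i j * z j * (y i : ℂ)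
    + (1 / 2) * ∑ i, ∑ j, φ.C i j * (y j : ℂ) * (y i : ℂ)

/-- The constant `c_φ = 2^{-d/2} π^{-3d/4} (det Im C)^{-1/4} |det B|`. -/
def const : ℝ :=
  (2 : ℝ) ^ (-(d : ℝ) / 2) * Real.pi ^ (-(3 * d : ℝ) / 4) *
    (φ.C.map Complex.im).det ^ (-(1 / 4) : ℝ) * ‖φ.B.det‖

/-- The weight `Φ(z) = max_{y ∈ ℝ^d} (-Im φ(z, y))`. -/
def weight (z : CSpace d) : ℝ := ⨆ y : RSpace d, -(φ.eval z y).im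

/-- The function `y ↦ e^{iφ(z, y)}`. -/
def kernel (z : CSpace d) : RSpace d → ℂ := fun y => Complex.exp (Complex.I * φ.eval z y)

/-- The bijection `χ^b_φ : T^*ℝ^d → ℂ^d`, the base component of the canonical transformation
`(y, -φ'_y(z, y)) ↦ (z, φ'_z(z, y))`: it maps `(x, ξ)` to the unique `z` with `φ'_y(z, x) = -ξ`,
that is, with `Bz + Cx = -ξ`. -/
def chi (p : RSpace d × RSpace d) : CSpace d :=
  WithLp.toLp 2 (-(φ.B⁻¹ *ᵥ fun i => (p.2 i : ℂ) + ∑ j, φ.C i j * (p.1 j : ℂ)))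

end FBIPhase

theorem norm_iteratedFDeriv_foldr_le {d : ℕ} (L : List (Fin d)) {f : RSpace d → ℂ}
    (hf : ContDiff ℝ ∞ f) (n : ℕ) (x : RSpace d) :
    ‖iteratedFDeriv ℝ n (L.foldr pderiv f) x‖ ≤ ‖iteratedFDeriv ℝ (n + L.length) f x‖ := by
  induction L generalizing n with
  | nil => exact le_rfl
  | cons i L ih =>
    have h := contDiff_foldr L hf
    have h1 : ContDiff ℝ ∞ (fderiv ℝ (L.foldr pderiv f)) := h.fderiv_right (by simp)
    refine (norm_iteratedFDeriv_clm_apply_const (h1.contDiffAt (x := x)) (n := n)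
      (by exact_mod_cast le_top)).trans ?_
    rw [PiLp.norm_single, norm_one, one_mul, norm_iteratedFDeriv_fderiv]
    refine (ih (n + 1)).trans (le_of_eq ?_)
    rw [List.length_cons, add_right_comm, add_assoc]

theorem norm_partialDeriv_le {d : ℕ} (β : Fin d → ℕ) {f : RSpace d → ℂ}
    (hf : ContDiff ℝ ∞ f) (x : RSpace d) :
    ‖partialDeriv β f x‖ ≤ ‖iteratedFDeriv ℝ (mdeg β) f x‖ := by
  obtain ⟨L, hL, h⟩ := exists_list β
  have := norm_iteratedFDeriv_foldr_le L hf 0 x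
  rwa [norm_iteratedFDeriv_zero, zero_add, hL, ← h] at this

/-- Derivatives of a function `f` with `f' = f · (a + T)`, `T` linear. -/
theorem norm_iteratedFDeriv_le_of_affine {d : ℕ} {f : RSpace d → ℂ} (hf : ContDiff ℝ ∞ f)
    (a : RSpace d →L[ℝ] ℂ) (T : RSpace d →L[ℝ] (RSpace d →L[ℝ] ℂ))
    (h : ∀ y, fderiv ℝ f y = f y • (a + T y)) {k : ℝ} (ha : ‖a‖ ≤ k) (hT : ‖T‖ ≤ k)
    (y : RSpace d) (n : ℕ) :
    ‖iteratedFDeriv ℝ n f y‖ ≤ ‖f y‖ * ((2 * k + 1) ^ n * (1 + ‖y‖ + √n) ^ n) := by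
  have hk : 0 ≤ k := (norm_nonneg a).trans ha
  set Λ : RSpace d → (RSpace d →L[ℝ] ℂ) := fun y => a + T y with hΛ
  have hΛd : ContDiff ℝ ∞ Λ := contDiff_const.add T.contDiff
  have hf' : fderiv ℝ f = fun y => f y • Λ y := funext h
  have hΛ' : fderiv ℝ Λ = fun _ => T := by
    ext1 y
    rw [hΛ, fderiv_const_add, ContinuousLinearMap.fderiv]
  have h0 : ‖iteratedFDeriv ℝ 0 Λ y‖ ≤ k * (1 + ‖y‖) := by
    rw [norm_iteratedFDeriv_zero]
    refine (norm_add_le _ _).trans ?_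
    have := (T.le_opNorm y).trans (mul_le_mul_of_nonneg_right hT (norm_nonneg y))
    linarith
  have h1 : ‖iteratedFDeriv ℝ 1 Λ y‖ ≤ k := by
    rw [← norm_iteratedFDeriv_fderiv, hΛ', norm_iteratedFDeriv_zero]
    exact hT
  have h2 : ∀ m, ‖iteratedFDeriv ℝ (m + 2) Λ y‖ = 0 := by
    intro m
    rw [← norm_iteratedFDeriv_fderiv, hΛ', iteratedFDeriv_succ_const]
    simp
  have rec0 : ‖iteratedFDeriv ℝ 1 f y‖ ≤ ‖f y‖ * (k * (1 + ‖y‖)) := by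
    rw [← norm_iteratedFDeriv_fderiv, hf', norm_iteratedFDeriv_zero, norm_smul]
    rw [norm_iteratedFDeriv_zero] at h0
    gcongr
  have rec1 : ∀ n : ℕ, ‖iteratedFDeriv ℝ (n + 2) f y‖ ≤
      ‖iteratedFDeriv ℝ (n + 1) f y‖ * (k * (1 + ‖y‖)) +
        ((n : ℝ) + 1) * ‖iteratedFDeriv ℝ n f y‖ * k := by
    intro n
    rw [← norm_iteratedFDeriv_fderiv, hf']
    refine (norm_iteratedFDeriv_smul_le hf hΛd y (n := n + 1) (by exact_mod_cast le_top)).trans ?_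
    rw [Finset.sum_range_succ, Finset.sum_range_succ, Finset.sum_eq_zero]
    · rw [zero_add, add_comm, Nat.sub_self, Nat.add_sub_cancel_left]
      simp only [Nat.choose_self, Nat.cast_one, one_mul, Nat.choose_succ_self_right]
      push_cast
      gcongr
    · intro i hi
      have hi' := Finset.mem_range.1 hi
      obtain ⟨m, hm⟩ : ∃ m, n + 1 - i = m + 2 := ⟨n - 1 - i, by omega⟩
      rw [hm, h2, mul_zero]
  set r := 1 + ‖y‖ with hr
  have hr1 : 1 ≤ r := by rw [hr]; linarith [norm_nonneg y]
  have main : ∀ n : ℕ, ‖iteratedFDeriv ℝ n f y‖ ≤ ‖f y‖ * ((2 * k + 1) ^ n * (r + √n) ^ n) ∧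
      ‖iteratedFDeriv ℝ (n + 1) f y‖ ≤
        ‖f y‖ * ((2 * k + 1) ^ (n + 1) * (r + √((n + 1 : ℕ) : ℝ)) ^ (n + 1)) := by
    intro n
    induction n with
    | zero =>
      refine ⟨by simp, rec0.trans ?_⟩
      simp only [zero_add, pow_one, Nat.cast_one, Real.sqrt_one]
      gcongr
      · linarith
      · linarith
    | succ n ih =>
      refine ⟨ih.2, (rec1 n).trans ?_⟩
      set K := 2 * k + 1 with hK
      have hK1 : 1 ≤ K := by linarith
      set R := r + √((n + 1 + 1 : ℕ) : ℝ) with hR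
      have hs1 : √(n : ℝ) ≤ √((n + 1 + 1 : ℕ) : ℝ) := Real.sqrt_le_sqrt (by push_cast; linarith)
      have hs2 : √((n + 1 : ℕ) : ℝ) ≤ √((n + 1 + 1 : ℕ) : ℝ) :=
        Real.sqrt_le_sqrt (by push_cast; linarith)
      have hrR : r ≤ R := by rw [hR]; linarith [Real.sqrt_nonneg ((n + 1 + 1 : ℕ) : ℝ)]
      have hR0 : 0 ≤ R := by linarith
      have hnR : (n : ℝ) + 1 ≤ R ^ 2 := by
        have h3 := Real.sq_sqrt (x := ((n + 1 + 1 : ℕ) : ℝ)) (by positivity)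
        have h4 : √((n + 1 + 1 : ℕ) : ℝ) ≤ R := by rw [hR]; linarith
        have h5 := pow_le_pow_left₀ (Real.sqrt_nonneg _) h4 2
        rw [h3] at h5
        push_cast at h5
        linarith
      have e1 : ‖iteratedFDeriv ℝ (n + 1) f y‖ ≤ ‖f y‖ * (K ^ (n + 1) * R ^ (n + 1)) := by
        refine ih.2.trans ?_
        gcongr
        rw [hR]
        gcongr
      have e2 : ‖iteratedFDeriv ℝ n f y‖ ≤ ‖f y‖ * (K ^ n * R ^ n) := by
        refine ih.1.trans ?_
        gcongr
        rw [hR]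
        gcongr
      calc _ ≤ ‖f y‖ * (K ^ (n + 1) * R ^ (n + 1)) * (k * R) +
            R ^ 2 * (‖f y‖ * (K ^ n * R ^ n)) * k := by gcongr
        _ = ‖f y‖ * (K ^ n * R ^ (n + 2)) * (k * K + k) := by ring
        _ ≤ ‖f y‖ * (K ^ n * R ^ (n + 2)) * (K ^ 2) := by
            gcongr
            nlinarith
        _ = _ := by ring
  exact (main n).1

theorem pow_mdeg_le {d : ℕ} (α : Fin d → ℕ) {x : ℝ} (hx : 0 ≤ x) :
    x ^ mdeg α ≤ Real.exp (d * x) * mfact α := by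
  have h : ∏ i, x ^ α i ≤ ∏ i, (Real.exp x * ((α i).factorial : ℝ)) := by
    refine Finset.prod_le_prod (fun i _ => by positivity) fun i _ => ?_
    have := Real.pow_div_factorial_le_exp x hx (α i)
    rwa [div_le_iff₀ (by positivity)] at this
  rw [Finset.prod_pow_eq_pow_sum, Finset.prod_mul_distrib, Finset.prod_const, Finset.card_univ,
    Fintype.card_fin, ← Real.exp_nat_mul] at h
  exact h

theorem abs_monom_le {d : ℕ} (α : Fin d → ℕ) (x : RSpace d) :
    |monom α x| ≤ (1 + ‖x‖) ^ mdeg α := by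
  unfold monom mdeg
  rw [Finset.abs_prod, ← Finset.prod_pow_eq_pow_sum]
  refine Finset.prod_le_prod (fun i _ => abs_nonneg _) fun i _ => ?_
  rw [abs_pow]
  refine pow_le_pow_left₀ (abs_nonneg _) ?_ _
  have := PiLp.norm_apply_le x i
  rw [Real.norm_eq_abs] at this
  linarith

theorem rpow_half_le {d : ℕ} (α : Fin d → ℕ) {θ : ℝ} (hθ : 1 / 2 ≤ θ) :
    √(mfact α) ≤ mfact α ^ θ := by
  rw [Real.sqrt_eq_rpow]
  exact Real.rpow_le_rpow_of_exponent_le (mfact_one_le α) hθ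

/-- A function `f` with `f' = f · (a + T)`, `T` linear, that has Gaussian decay lies in `S_θ` for
every `θ ≥ 1/2`. -/
theorem mem_GS_of_affine {d : ℕ} {θ : ℝ} (hθ : 1 / 2 ≤ θ) {f : RSpace d → ℂ}
    (hf : ContDiff ℝ ∞ f) (a : RSpace d →L[ℝ] ℂ) (T : RSpace d →L[ℝ] (RSpace d →L[ℝ] ℂ))
    (h : ∀ y, fderiv ℝ f y = f y • (a + T y)) {c M : ℝ} (hc : 0 < c) (hM : 0 ≤ M)
    (hfM : ∀ y, ‖f y‖ ≤ M * Real.exp (-(c * (1 + ‖y‖) ^ 2))) : f ∈ GS θ d := by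
  refine ⟨hf, ?_⟩
  set k := max ‖a‖ ‖T‖ with hk
  have hk0 : 0 ≤ k := (norm_nonneg a).trans (le_max_left _ _)
  set s := c / (d + 1) with hs
  have hs0 : 0 < s := by positivity
  have hds : d * s ≤ c := by
    rw [hs, mul_div_assoc', div_le_iff₀ (by positivity)]
    nlinarith
  set S := √(s⁻¹) with hS
  set E := √(Real.exp d) with hE
  set K := 2 * (2 * k + 1) with hK
  have hS0 : 0 < S := Real.sqrt_pos.2 (by positivity)
  have hE0 : 0 < E := Real.sqrt_pos.2 (by positivity)
  -- powers of r
  have p1 : ∀ (α : Fin d → ℕ) (r : ℝ), 0 ≤ r →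
      r ^ mdeg α ≤ S ^ mdeg α * √(mfact α) * Real.exp (c * r ^ 2 / 2) := by
    intro α r hr
    have h1 := pow_mdeg_le α (x := s * r ^ 2) (by positivity)
    have h2 : (r ^ mdeg α) ^ 2 ≤ (S ^ mdeg α * √(mfact α) * Real.exp (c * r ^ 2 / 2)) ^ 2 := by
      have e1 : (S ^ mdeg α) ^ 2 = (s ^ mdeg α)⁻¹ := by
        rw [← pow_mul, mul_comm, pow_mul, hS, Real.sq_sqrt (by positivity), inv_pow]
      have e2 : √(mfact α) ^ 2 = mfact α :=
        Real.sq_sqrt (zero_le_one.trans (mfact_one_le α))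
      have e3 : Real.exp (c * r ^ 2 / 2) ^ 2 = Real.exp (c * r ^ 2) := by
        rw [← Real.exp_nat_mul]; congr 1; push_cast; ring
      rw [mul_pow, mul_pow, e1, e2, e3, mul_assoc, le_inv_mul_iff₀ (by positivity)]
      calc s ^ mdeg α * (r ^ mdeg α) ^ 2 = (s * r ^ 2) ^ mdeg α := by ring
        _ ≤ _ := h1
        _ ≤ Real.exp (c * r ^ 2) * mfact α := by
            have := mfact_one_le α
            gcongr ?_ * _
            refine Real.exp_le_exp.2 ?_
            rw [← mul_assoc]
            exact mul_le_mul_of_nonneg_right hds (sq_nonneg r)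
        _ = _ := mul_comm _ _
    exact le_of_sq_le_sq h2 (by positivity)
  have p2 : ∀ (β : Fin d → ℕ), √(mdeg β : ℝ) ^ mdeg β ≤ E ^ mdeg β * √(mfact β) := by
    intro β
    have h1 := pow_mdeg_le β (x := (mdeg β : ℝ)) (by positivity)
    have h2 : (√(mdeg β : ℝ) ^ mdeg β) ^ 2 ≤ (E ^ mdeg β * √(mfact β)) ^ 2 := by
      rw [mul_pow, ← pow_mul, mul_comm (mdeg β) 2, pow_mul, Real.sq_sqrt (by positivity),
        ← pow_mul, mul_comm (mdeg β) 2, pow_mul, hE, Real.sq_sqrt (by positivity),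
        Real.sq_sqrt (zero_le_one.trans (mfact_one_le β)), ← Real.exp_nat_mul, mul_comm _ (d : ℝ)]
      exact h1
    exact le_of_sq_le_sq h2 (by positivity)
  set Q := S + K * (S + E) + 1 with hQ
  have hQ0 : 0 < Q := by positivity
  refine ⟨Q, hQ0, (gsNorm_lt_top_iff hQ0).2 ⟨2 * M, by positivity, ?_⟩⟩
  intro α β y
  set r := 1 + ‖y‖ with hr
  have hr0 : 0 ≤ r := by positivity
  set A := √(mfact α)
  set B := √(mfact β)
  set m := mdeg α
  set n := mdeg β
  have hA : A ≤ mfact α ^ θ := rpow_half_le α hθ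
  have hB : B ≤ mfact β ^ θ := rpow_half_le β hθ
  have q1 : (r + √n) ^ n ≤ 2 ^ n * (r ^ n + √n ^ n) := by
    refine (add_pow_le hr0 (Real.sqrt_nonneg _) n).trans ?_
    gcongr
    · norm_num
    · omega
  have q2 : r ^ n + √n ^ n ≤ 2 * ((S + E) ^ n * B * Real.exp (c * r ^ 2 / 2)) := by
    have t1 : r ^ n ≤ (S + E) ^ n * B * Real.exp (c * r ^ 2 / 2) := by
      refine (p1 β r hr0).trans ?_
      gcongr
      linarith
    have t2 : √n ^ n ≤ (S + E) ^ n * B * Real.exp (c * r ^ 2 / 2) := by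
      refine (p2 β).trans ?_
      have : 1 ≤ Real.exp (c * r ^ 2 / 2) := Real.one_le_exp (by positivity)
      refine le_trans ?_ (le_mul_of_one_le_right (by positivity) this)
      gcongr
      linarith
    linarith
  have q3 : ‖partialDeriv β f y‖ ≤ M * Real.exp (-(c * r ^ 2)) *
      ((2 * k + 1) ^ n * (r + √n) ^ n) := by
    refine (norm_partialDeriv_le β hf y).trans ?_
    refine (norm_iteratedFDeriv_le_of_affine hf a T h (le_max_left _ _) (le_max_right _ _)
      y _).trans ?_
    gcongr
    exact hfM y
  rw [norm_mul, Complex.norm_real, Real.norm_eq_abs]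
  calc |monom α y| * ‖partialDeriv β f y‖
      ≤ (S ^ m * A * Real.exp (c * r ^ 2 / 2)) * (M * Real.exp (-(c * r ^ 2)) *
        ((2 * k + 1) ^ n * (2 ^ n * (2 * ((S + E) ^ n * B * Real.exp (c * r ^ 2 / 2)))))) := by
        refine mul_le_mul ((abs_monom_le α y).trans (p1 α r hr0)) (q3.trans ?_)
          (norm_nonneg _) (by positivity)
        gcongr
        exact q1.trans (by gcongr)
    _ = 2 * M * (S ^ m * (K * (S + E)) ^ n * A * B) *
        (Real.exp (c * r ^ 2 / 2) * Real.exp (-(c * r ^ 2)) * Real.exp (c * r ^ 2 / 2)) := by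
        rw [hK, mul_pow, mul_pow]; ring
    _ = 2 * M * (S ^ m * (K * (S + E)) ^ n * A * B) := by
        rw [← Real.exp_add, ← Real.exp_add,
          show c * r ^ 2 / 2 + -(c * r ^ 2) + c * r ^ 2 / 2 = 0 by ring, Real.exp_zero, mul_one]
    _ ≤ 2 * M * (Q ^ m * Q ^ n * mfact α ^ θ * mfact β ^ θ) := by
        have hKS : 0 ≤ K * (S + E) := by positivity
        have hSQ : S ≤ Q := by linarith
        have hKQ : K * (S + E) ≤ Q := by linarith
        have hα1 := mfact_one_le α
        have hQ1 : 0 ≤ Q ^ m * Q ^ n * mfact α ^ θ := by positivity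
        gcongr
    _ = _ := by rw [← pow_add]

namespace FBIPhase

variable {d : ℕ} (φ : FBIPhase d)

/-- The `y`-gradient of `φ`: `φ'_y(z, y) = Bz + Cy`. -/
theorem hasFDerivAt_eval (z : CSpace d) (y : RSpace d) :
    HasFDerivAt (φ.eval z) (∑ i, ((∑ j, φ.B i j * z j) + ∑ j, φ.C i j * (y j : ℂ)) •
      (Complex.ofRealCLM ∘L (EuclideanSpace.proj i : RSpace d →L[ℝ] ℝ))) y := by
  set P : Fin d → (RSpace d →L[ℝ] ℂ) := fun i =>
    Complex.ofRealCLM ∘L (EuclideanSpace.proj i : RSpace d →L[ℝ] ℝ) with hP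
  have hc : ∀ i, HasFDerivAt (fun y : RSpace d => (y i : ℂ)) (P i) y := fun i =>
    (P i).hasFDerivAt
  have h1 : HasFDerivAt (fun y : RSpace d => ∑ i, ∑ j, φ.B i j * z j * (y i : ℂ))
      (∑ i, ∑ j, (φ.B i j * z j) • P i) y :=
    HasFDerivAt.fun_sum fun i _ => HasFDerivAt.fun_sum fun j _ => (hc i).const_mul _
  have h2 : HasFDerivAt (fun y : RSpace d => (1 / 2 : ℂ) * ∑ i, ∑ j, φ.C i j * (y j : ℂ) * (y i : ℂ))
      ((1 / 2 : ℂ) • ∑ i, ∑ j, ((φ.C i j * (y j : ℂ)) • P i + (y i : ℂ) • φ.C i j • P j)) y :=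
    (HasFDerivAt.fun_sum fun i _ => HasFDerivAt.fun_sum fun j _ =>
      ((hc j).const_mul _).mul (hc i)).const_mul _
  refine ((h1.const_add ((1 / 2) * ∑ i, ∑ j, φ.A i j * z j * z i)).add h2).congr_fderiv ?_
  have e : ∑ i, ∑ j, (y i : ℂ) • φ.C i j • P j = ∑ i, ∑ j, (φ.C i j * (y j : ℂ)) • P i := by
    rw [Finset.sum_comm]
    refine Finset.sum_congr rfl fun i _ => Finset.sum_congr rfl fun j _ => ?_
    rw [smul_smul, φ.symm_C.apply, mul_comm]
  simp only [Finset.sum_add_distrib, e]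
  rw [← two_smul ℂ (∑ i, ∑ j, (φ.C i j * (y j : ℂ)) • P i), smul_smul]
  ext v
  simp only [add_apply, sum_apply, smul_apply, smul_eq_mul, add_mul, Finset.sum_mul,
    Finset.sum_add_distrib, hP]
  norm_num

/-- `φ'_y(z, x) = -ξ` at `z = χ^b_φ(x, ξ)`. -/
theorem pderiv_eval_chi (p : RSpace d × RSpace d) (i : Fin d) :
    pderiv i (φ.eval (φ.chi p)) p.1 = -(p.2 i : ℂ) := by
  have hB : IsUnit φ.B.det := isUnit_iff_ne_zero.2 φ.det_B
  have h : ∑ j, φ.B i j * φ.chi p j = -((p.2 i : ℂ) + ∑ j, φ.C i j * (p.1 j : ℂ)) := by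
    have h1 : φ.B *ᵥ (-(φ.B⁻¹ *ᵥ fun i => (p.2 i : ℂ) + ∑ j, φ.C i j * (p.1 j : ℂ))) =
        -fun i => (p.2 i : ℂ) + ∑ j, φ.C i j * (p.1 j : ℂ) := by
      rw [Matrix.mulVec_neg, Matrix.mulVec_mulVec, Matrix.mul_nonsing_inv _ hB, Matrix.one_mulVec]
    exact congrFun h1 i
  rw [pderiv, (φ.hasFDerivAt_eval _ _).fderiv, sum_apply,
    Finset.sum_eq_single i]
  · simp [h]
  · intro j _ hj
    simp [hj]
  · simp

theorem im_eval_lower (z : CSpace d) : ∃ c a b : ℝ, 0 < c ∧ ∀ y : RSpace d,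
    c * ‖y‖ ^ 2 - a * ‖y‖ - b ≤ (φ.eval z y).im := by
  -- the quadratic part, by compactness of the unit sphere
  obtain ⟨c, hc, hcq⟩ : ∃ c : ℝ, 0 < c ∧ ∀ y : RSpace d,
      c * ‖y‖ ^ 2 ≤ ∑ i, ∑ j, (φ.C i j).im * y j * y i := by
    set q : RSpace d → ℝ := fun y => ∑ i, ∑ j, (φ.C i j).im * y j * y i with hq
    have hqc : Continuous q := by fun_prop
    have hqpos : ∀ y, y ≠ 0 → 0 < q y := by
      intro y hy
      have hy' : y.ofLp ≠ 0 := fun h => hy (by ext i; exact congrFun h i)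
      have := φ.posDef_im_C.dotProduct_mulVec_pos hy'
      simp only [dotProduct, Matrix.mulVec, Pi.star_apply, star_trivial, Matrix.map_apply,
        Finset.mul_sum] at this
      refine this.trans_eq (Finset.sum_congr rfl fun i _ => Finset.sum_congr rfl fun j _ => ?_)
      ring
    have hqh : ∀ (t : ℝ) y, q (t • y) = t ^ 2 * q y := by
      intro t y
      simp only [hq, PiLp.smul_apply, smul_eq_mul, Finset.mul_sum]
      refine Finset.sum_congr rfl fun i _ => Finset.sum_congr rfl fun j _ => ?_
      ring
    rcases (Metric.sphere (0 : RSpace d) 1).eq_empty_or_nonempty with he | hne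
    · refine ⟨1, one_pos, fun y => ?_⟩
      have hy : y = 0 := by
        by_contra hy
        have : (‖y‖⁻¹ • y) ∈ Metric.sphere (0 : RSpace d) 1 := by
          simp [norm_smul, hy]
        rw [he] at this
        exact this
      simp [hy]
    · obtain ⟨y₀, hy₀, hmin⟩ := (isCompact_sphere (0 : RSpace d) 1).exists_isMinOn hne
        hqc.continuousOn
      have hy₀' : y₀ ≠ 0 := by
        rintro rfl
        simp at hy₀
      refine ⟨q y₀, hqpos y₀ hy₀', fun y => ?_⟩
      rcases eq_or_ne y 0 with rfl | hy
      · simp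
      · have hmem : (‖y‖⁻¹ • y) ∈ Metric.sphere (0 : RSpace d) 1 := by
          simp [norm_smul, hy]
        have h1 : q y₀ ≤ q (‖y‖⁻¹ • y) := hmin hmem
        rw [hqh] at h1
        have h2 : 0 < ‖y‖ := norm_pos_iff.2 hy
        rw [inv_pow, le_inv_mul_iff₀ (by positivity)] at h1
        rw [mul_comm]
        exact h1
  refine ⟨c / 2, ∑ i, ∑ j, ‖φ.B i j * z j‖, ‖(1 / 2 : ℂ) * ∑ i, ∑ j, φ.A i j * z j * z i‖,
    by positivity, fun y => ?_⟩
  have h1 : ((1 / 2 : ℂ) * ∑ i, ∑ j, φ.C i j * (y j : ℂ) * (y i : ℂ)).im =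
      (1 / 2) * ∑ i, ∑ j, (φ.C i j).im * y j * y i := by
    have : (1 / 2 : ℂ) = ((1 / 2 : ℝ) : ℂ) := by norm_num
    rw [this, Complex.im_ofReal_mul]
    simp only [Complex.im_sum, Complex.im_mul_ofReal]
  have h2 : -((∑ i, ∑ j, ‖φ.B i j * z j‖) * ‖y‖) ≤
      (∑ i, ∑ j, φ.B i j * z j * (y i : ℂ)).im := by
    refine neg_le_of_abs_le ((Complex.abs_im_le_norm _).trans ?_)
    rw [Finset.sum_mul]
    refine (norm_sum_le _ _).trans (Finset.sum_le_sum fun i _ => ?_)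
    rw [Finset.sum_mul]
    refine (norm_sum_le _ _).trans (Finset.sum_le_sum fun j _ => ?_)
    rw [norm_mul, Complex.norm_real]
    exact mul_le_mul_of_nonneg_left (PiLp.norm_apply_le y i) (norm_nonneg _)
  have h3 := neg_le_of_abs_le
    (Complex.abs_im_le_norm ((1 / 2 : ℂ) * ∑ i, ∑ j, φ.A i j * z j * z i))
  have h4 := hcq y
  unfold eval
  rw [Complex.add_im, Complex.add_im, h1]
  linarith

/-- The functions `y ↦ e^{iφ(z, y)}` lie in `S_θ(ℝ^d)` for `θ ≥ 1/2`. -/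
theorem kernel_mem {θ : ℝ} (hθ : 1 / 2 ≤ θ) (z : CSpace d) : φ.kernel z ∈ GS θ d := by
  set P : Fin d → (RSpace d →L[ℝ] ℂ) := fun i =>
    Complex.ofRealCLM ∘L (EuclideanSpace.proj i : RSpace d →L[ℝ] ℝ) with hP
  have hcd : ContDiff ℝ ∞ (φ.kernel z) := by
    unfold kernel eval
    have hc : ∀ i, ContDiff ℝ ∞ (fun y : RSpace d => (y i : ℂ)) := fun i => (P i).contDiff
    refine Complex.contDiff_exp.comp (contDiff_const.mul ((contDiff_const.add ?_).add
      (contDiff_const.mul ?_)))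
    · exact ContDiff.sum fun i _ => ContDiff.sum fun j _ => contDiff_const.mul (hc i)
    · exact ContDiff.sum fun i _ => ContDiff.sum fun j _ => (contDiff_const.mul (hc j)).mul (hc i)
  set a : RSpace d →L[ℝ] ℂ := ∑ i, (Complex.I * ∑ j, φ.B i j * z j) • P i with ha
  set T : RSpace d →L[ℝ] (RSpace d →L[ℝ] ℂ) := ∑ i, ∑ j,
    (EuclideanSpace.proj j : RSpace d →L[ℝ] ℝ).smulRight ((Complex.I * φ.C i j) • P i) with hT
  have hd : ∀ y, fderiv ℝ (φ.kernel z) y = φ.kernel z y • (a + T y) := by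
    intro y
    have h1 := ((φ.hasFDerivAt_eval z y).const_mul Complex.I).cexp
    have h2 : fderiv ℝ (φ.kernel z) y = _ := h1.fderiv
    rw [h2]
    unfold kernel
    have hpr : ∀ (i : Fin d) (v : RSpace d),
      (EuclideanSpace.proj i : RSpace d →L[ℝ] ℝ) v = v i := fun i v => rfl
    congr 1
    ext v
    simp only [ha, hT, add_apply, sum_apply,
      smul_apply, ContinuousLinearMap.smulRight_apply, smul_eq_mul,
      Complex.real_smul, Finset.mul_sum, hP, ContinuousLinearMap.comp_apply, hpr, Complex.ofRealCLM_apply, ← Finset.sum_add_distrib,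
      add_mul, mul_add, Finset.sum_mul]
    refine Finset.sum_congr rfl fun i _ => Finset.sum_congr rfl fun j _ => ?_
    ring
  obtain ⟨c, k, b, hc, hb⟩ := φ.im_eval_lower z
  refine mem_GS_of_affine hθ hcd a T hd (c := c / 4) (M := Real.exp (c / 2 + k ^ 2 / c + |b|))
    (by positivity) (Real.exp_pos _).le fun y => ?_
  rw [kernel, Complex.norm_exp, ← Real.exp_add, Real.exp_le_exp]
  have h1 : (Complex.I * φ.eval z y).re = -(φ.eval z y).im := by simp
  rw [h1]
  have h2 := hb y
  have h3 := le_abs_self b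
  have h4 : k * ‖y‖ ≤ k ^ 2 / c + c / 4 * ‖y‖ ^ 2 := by
    have : 0 ≤ (k / c - ‖y‖ / 2) ^ 2 * c := by positivity
    have e : (k / c - ‖y‖ / 2) ^ 2 * c = k ^ 2 / c - k * ‖y‖ + c / 4 * ‖y‖ ^ 2 := by
      field_simp
      ring
    linarith
  nlinarith [mul_nonneg hc.le (sq_nonneg (‖y‖ - 1))]

/-- The supremum defining `Φ(z)` is over a set that is bounded above. -/
theorem bddAbove_neg_im_eval (z : CSpace d) :
    BddAbove (Set.range fun y : RSpace d => -(φ.eval z y).im) := by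
  obtain ⟨c, k, b, hc, hb⟩ := φ.im_eval_lower z
  refine ⟨k ^ 2 / (4 * c) + b, ?_⟩
  rintro _ ⟨y, rfl⟩
  have h2 := hb y
  have : 0 ≤ (k / (2 * c) - ‖y‖) ^ 2 * c := by positivity
  have e : (k / (2 * c) - ‖y‖) ^ 2 * c = k ^ 2 / (4 * c) - k * ‖y‖ + c * ‖y‖ ^ 2 := by
    field_simp
    ring
  simp only
  linarith

end FBIPhase

/-- The FBI transform `T_φ u (z) = c_φ ⟨u_y, e^{iφ(z, y)}⟩` of `u ∈ S'_θ(ℝ^d)`. -/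
def fbi {θ : ℝ} {d : ℕ} (hθ : 1 / 2 ≤ θ) (φ : FBIPhase d) (u : GSDual θ d) (z : CSpace d) : ℂ :=
  (φ.const : ℂ) * u.toLinearMap ⟨φ.kernel z, φ.kernel_mem hθ z⟩

/-! ### The global wave front set -/

/-- A set is conic if it is invariant under multiplication by positive real numbers. -/
def IsConic {V : Type*} [SMul ℝ V] (s : Set V) : Prop :=
  ∀ t : ℝ, 0 < t → ∀ v ∈ s, t • v ∈ s

/-- The global wave front set `WF^θ_gl(u) ⊆ T^*ℝ^d ∖ {0}`, computed with the phase `φ`: a point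
`p ≠ 0` is *not* in it if there are an open conic neighbourhood `L` of `χ^b_φ(p)` in `ℂ^d ∖ {0}`
and `ε > 0`, `K > 0` with `|T_φ u(z)| ≤ K e^{-ε |z|^{1/θ} + Φ(z)}` for all `z ∈ L`. -/
def WF {θ : ℝ} {d : ℕ} (hθ : 1 / 2 ≤ θ) (φ : FBIPhase d) (u : GSDual θ d) :
    Set (RSpace d × RSpace d) :=
  {p | p ≠ 0 ∧ ¬ ∃ L : Set (CSpace d), IsOpen L ∧ IsConic L ∧ 0 ∉ L ∧ φ.chi p ∈ L ∧
    ∃ ε : ℝ, 0 < ε ∧ ∃ K : ℝ, 0 < K ∧ ∀ z ∈ L,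
      ‖fbi hθ φ u z‖ ≤ K * Real.exp (-ε * ‖z‖ ^ (1 / θ) + φ.weight z)}

end GelfandShilov
end

open scoped ENNReal NNReal ContDiff Matrix

noncomputable section

namespace GelfandShilov

/-! ### Gaussian integrals with complex quadratic exponent -/

section GaussianIntegrals

open MeasureTheory Complex Filter Topology
open scoped InnerProductSpace FourierTransform

/-! The distribution is a lacunary sum of coherent states `u = ∑ₖ g_{p k}`, with centres `p k ∈ Γ`,
`‖p k‖ = 2 ^ k`, whose directions run through a dense set of directions of `Γ`, each one infinitely
often. Nothing in `u` refers to a phase, so one `u` serves all `φ`.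

Each term is explicit: Taylor expansion of `φ(χ(q), ·)` at the base point of `q` is exact and gives
`|⟨g_p, e^{iφ(χ(q),·)}⟩| = e^{Φ(χ(q))} |G(p - q)|`, where the overlap `G` depends only on `C`
(`norm_coherentPairing_kernel`). Two facts about `G` are enough: it has Gaussian decay in phase
space (`exists_gaussOverlap_le`), and it is nonzero at some point `(0, η)`
(`exists_gaussOverlap_ne_zero`).

Convergence in the dual space: pairing with `g_p` gains a factor `‖p‖⁻¹`, so the series is dominated
by a geometric one.

No singularity off `Γ`: on a cone away from `Γ`, `‖p j - q‖` dominates both `‖q‖` and `2 ^ j`, so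
`e^{-Φ} |T u|` is `O(e^{-k‖q‖²})`. Since `1/θ ≤ 2`, this is stronger than the required decay.

Singularity on `Γ`: at `q = p k - (0, η)` the `k`-th term has modulus exactly `|G(0, η)| e^Φ`, while
by lacunarity the others add up to `o(e^Φ)`. Any open cone around a point of `Γ` contains infinitely
many of these `q`, so no decay holds there. -/

theorem norm_cexp_add_mul_le {E : Type*} [NormedAddCommGroup E] [NormedSpace ℝ E]
    {A : E → ℂ} {K k : ℝ}
    (h : ∀ w, (A w).re ≤ K - k * ‖w‖ ^ 2)
    (l : E →L[ℝ] ℂ) (s : ℂ) (w : E) :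
    ‖cexp (A w + s * l w)‖ ≤ Real.exp K * Real.exp (-k * ‖w‖ ^ 2 + ‖s‖ * ‖l‖ * ‖w‖) := by
  rw [norm_exp, ← Real.exp_add, Real.exp_le_exp, add_re]
  have h1 : (s * l w).re ≤ ‖s‖ * ‖l‖ * ‖w‖ := by
    refine (re_le_norm _).trans ?_
    rw [norm_mul, mul_assoc]
    exact mul_le_mul_of_nonneg_left (l.le_opNorm w) (norm_nonneg s)
  linarith [h w]

variable {E : Type*} [NormedAddCommGroup E] [InnerProductSpace ℝ E] [FiniteDimensional ℝ E]
  [MeasurableSpace E] [BorelSpace E]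

theorem integrable_exp_neg_mul_sq_norm {k : ℝ} (hk : 0 < k) :
    Integrable (fun w : E => Real.exp (-k * ‖w‖ ^ 2)) := by
  have h := (GaussianFourier.integrable_cexp_neg_mul_sq_norm_add (V := E) (b := (k : ℂ))
    (by simpa using hk) 0 0).norm
  refine h.congr (ae_of_all _ fun w => ?_)
  simp only [norm_exp]
  congr 1
  simp [← Complex.ofReal_pow]

theorem integrable_exp_neg_mul_sq_norm_add_mul_norm {k : ℝ} (hk : 0 < k) (R : ℝ) :
    Integrable (fun w : E => Real.exp (-k * ‖w‖ ^ 2 + R * ‖w‖)) := by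
  refine ((integrable_exp_neg_mul_sq_norm (E := E) (half_pos hk)).const_mul
    (Real.exp (R ^ 2 / (2 * k)))).mono' (by fun_prop) (ae_of_all _ fun w => ?_)
  rw [Real.norm_eq_abs, Real.abs_exp, ← Real.exp_add, Real.exp_le_exp]
  have e : R ^ 2 / (2 * k) + -(k / 2) * ‖w‖ ^ 2 - (-k * ‖w‖ ^ 2 + R * ‖w‖) =
      k / 2 * (‖w‖ - R / k) ^ 2 := by
    field_simp
    ring
  have : 0 ≤ k / 2 * (‖w‖ - R / k) ^ 2 := by positivity
  linarith

theorem integrable_cexp_add_mul {A : E → ℂ} (hA : Continuous A) {K k : ℝ} (hk : 0 < k)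
    (h : ∀ w, (A w).re ≤ K - k * ‖w‖ ^ 2) (l : E →L[ℝ] ℂ) (s : ℂ) :
    Integrable (fun w => cexp (A w + s * l w)) :=
  ((integrable_exp_neg_mul_sq_norm_add_mul_norm (E := E) hk (‖s‖ * ‖l‖)).const_mul
    (Real.exp K)).mono' (by fun_prop : Continuous _).aestronglyMeasurable
    (ae_of_all _ (norm_cexp_add_mul_le h l s))

theorem differentiable_integral_cexp_add_mul {A : E → ℂ} (hA : Continuous A) {K k : ℝ} (hk : 0 < k)
    (h : ∀ w, (A w).re ≤ K - k * ‖w‖ ^ 2) (l : E →L[ℝ] ℂ) :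
    Differentiable ℂ (fun s : ℂ => ∫ w, cexp (A w + s * l w)) := by
  intro s₀
  have key := hasDerivAt_integral_of_dominated_loc_of_deriv_le (μ := (volume : Measure E))
    (F := fun (s : ℂ) w => cexp (A w + s * l w))
    (F' := fun (s : ℂ) w => cexp (A w + s * l w) * l w) (x₀ := s₀)
    -- In `‖s₀‖ + 2`, one unit bounds `‖s‖` on the unit ball around `s₀`, the other absorbs the
    -- factor `l w` through `‖l w‖ ≤ e^{‖l‖‖w‖}`.
    (bound := fun w => Real.exp K * Real.exp (-k * ‖w‖ ^ 2 + (‖s₀‖ + 2) * ‖l‖ * ‖w‖))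
    (Metric.ball_mem_nhds s₀ one_pos)
    (Eventually.of_forall fun s => (by fun_prop : Continuous _).aestronglyMeasurable)
    (integrable_cexp_add_mul hA hk h l s₀) (by fun_prop : Continuous _).aestronglyMeasurable
    (ae_of_all _ fun w s hs => ?_)
    ((integrable_exp_neg_mul_sq_norm_add_mul_norm (E := E) hk _).const_mul _)
    (ae_of_all _ fun w s _ => ?_)
  · exact key.2.differentiableAt
  · have hs' : ‖s‖ ≤ ‖s₀‖ + 1 := by
      have : ‖s‖ ≤ ‖s₀‖ + ‖s - s₀‖ := by
        simpa using norm_add_le s₀ (s - s₀)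
      have h3 := mem_ball_iff_norm.1 hs
      linarith
    have h1 : ‖l w‖ ≤ Real.exp (‖l‖ * ‖w‖) :=
      (l.le_opNorm w).trans ((le_add_of_nonneg_right zero_le_one).trans (Real.add_one_le_exp _))
    rw [norm_mul]
    calc _ ≤ (Real.exp K * Real.exp (-k * ‖w‖ ^ 2 + ‖s‖ * ‖l‖ * ‖w‖)) *
          Real.exp (‖l‖ * ‖w‖) := by
          gcongr
          exact norm_cexp_add_mul_le h l s w
      _ = Real.exp K * Real.exp (-k * ‖w‖ ^ 2 + (‖s‖ + 1) * ‖l‖ * ‖w‖) := by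
          rw [mul_assoc, ← Real.exp_add]; ring_nf
      _ ≤ _ := by
          have h4 : (‖s‖ + 1) * (‖l‖ * ‖w‖) ≤ (‖s₀‖ + 2) * (‖l‖ * ‖w‖) := by
            refine mul_le_mul_of_nonneg_right (by linarith) (by positivity)
          refine mul_le_mul_of_nonneg_left (Real.exp_le_exp.2 ?_) (Real.exp_pos K).le
          linarith
  · have := (((hasDerivAt_id s).mul_const (l w)).const_add (A w)).cexp
    simpa using this

/-- Complex translation of the domain of integration for the exponential of a function that is
quadratic along the direction of the translation. -/
theorem integral_cexp_complex_shift {A : E → ℂ} (hA : Continuous A) {K k : ℝ} (hk : 0 < k)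
    (h : ∀ w, (A w).re ≤ K - k * ‖w‖ ^ 2) (l : E →L[ℝ] ℂ) (κ γ : ℂ) (v : E)
    (hq : ∀ (w : E) (t : ℝ), A (w + t • v) = A w + t * l w + (t * κ + t ^ 2 * γ)) (s : ℂ) :
    ∫ w, cexp (A w) = cexp (s * κ + s ^ 2 * γ) * ∫ w, cexp (A w + s * l w) := by
  set F : ℂ → ℂ := fun s => cexp (s * κ + s ^ 2 * γ) * ∫ w, cexp (A w + s * l w) with hF
  have hd : Differentiable ℂ F :=
    (by fun_prop : Differentiable ℂ fun s : ℂ => cexp (s * κ + s ^ 2 * γ)).mul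
      (differentiable_integral_cexp_add_mul hA hk h l)
  -- For real `s` this is translation invariance of Lebesgue measure. As `F` is entire and constant
  -- on the real axis, which accumulates at `0`, the identity theorem makes it constant on `ℂ`.
  have hreal : ∀ t : ℝ, F t = ∫ w, cexp (A w) := by
    intro t
    rw [← integral_add_right_eq_self (fun w => cexp (A w)) (t • v), hF]
    simp only
    rw [← integral_const_mul]
    refine integral_congr_ae (ae_of_all _ fun w => ?_)
    simp only
    rw [hq, ← Complex.exp_add, add_comm]
  have han : AnalyticOnNhd ℂ F Set.univ := hd.differentiableOn.analyticOnNhd isOpen_univ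
  have hfreq : ∃ᶠ z in 𝓝[≠] (0 : ℂ), F z = (fun _ => ∫ w, cexp (A w)) z := by
    have ht : Tendsto (fun t : ℝ => (t : ℂ)) (𝓝[≠] 0) (𝓝[≠] 0) := by
      refine tendsto_nhdsWithin_of_tendsto_nhds_of_eventually_within _ ?_ ?_
      · exact (Complex.continuous_ofReal.tendsto' 0 0 (by simp)).mono_left nhdsWithin_le_nhds
      · filter_upwards [self_mem_nhdsWithin] with t ht
        simpa using ht
    exact ht.frequently (Eventually.of_forall hreal).frequently
  have := han.eq_of_frequently_eq analyticOnNhd_const hfreq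
  exact (congrFun this s).symm

/-- The overlap of a coherent state at `(a, η)` with the Gaussian `exp(½ i c(w, w))`. -/
def gaussOverlap (c : E →L[ℝ] E →L[ℝ] ℂ) (a η : E) : ℂ :=
  ∫ w, cexp (-(1 / 2) * ‖w - a‖ ^ 2 + I * (⟪η, w⟫_ℝ : ℝ) + I / 2 * c w w)

/-- Decay in `a` comes from the moduli of the two Gaussians. Decay in `η` comes from oscillation:
moving the domain of integration by `iτη` gains `e^{-τ‖η‖²}`, and all losses are quadratic in `τ`,
so a small `τ` wins. -/
theorem exists_gaussOverlap_le (c : E →L[ℝ] E →L[ℝ] ℂ) (hsymm : ∀ v w, c v w = c w v) {m : ℝ}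
    (hm : 0 < m) (hc : ∀ w, m * ‖w‖ ^ 2 ≤ (c w w).im) :
    ∃ K k : ℝ, 0 < K ∧ 0 < k ∧ ∀ a η : E,
      ‖gaussOverlap c a η‖ ≤ K * Real.exp (-k * (‖a‖ ^ 2 + ‖η‖ ^ 2)) := by
  set N := ‖c‖ with hN
  have hN0 : 0 ≤ N := norm_nonneg c
  -- `τ² κ₀ ‖η‖²` is the total loss of the shift: `(1 + N) / 2` from its quadratic terms, `N² / m`
  -- from the cross term in `w` and `η`. The choice of `τ` makes the loss half the gain `τ ‖η‖²`.
  set κ₀ := (1 + N) / 2 + N ^ 2 / m with hκ₀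
  have hκ₀pos : 0 < κ₀ := by positivity
  set τ := 1 / (2 * κ₀) with hτ
  have hτ0 : 0 < τ := by positivity
  -- Of the available `m / 2 * ‖w‖ ^ 2`, the cross term uses `m / 4`, the passage from `‖w - a‖` to
  -- `‖a‖` uses `m / 8`, and `m / 8` remains for integrability.
  set k₁ := min (1 / 2) (m / 8) with hk₁
  have hk₁0 : 0 < k₁ := by positivity
  set K := ∫ w : E, Real.exp (-(m / 8) * ‖w‖ ^ 2) with hK
  have hK0 : 0 ≤ K := integral_nonneg fun w => (Real.exp_pos _).le
  refine ⟨K + 1, min (k₁ / 2) (τ / 2), by positivity, by positivity, fun a η => ?_⟩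
  set A : E → ℂ := fun w => -(1 / 2) * ‖w - a‖ ^ 2 + I * (⟪η, w⟫_ℝ : ℝ) + I / 2 * c w w with hAdef
  have hAc : Continuous A := by
    have : Continuous fun w => c w w := c.continuous.clm_apply continuous_id
    fun_prop
  have hre : ∀ w, (A w).re = -(1 / 2) * ‖w - a‖ ^ 2 - (c w w).im / 2 := by
    intro w
    simp only [hAdef, ← ofReal_pow, div_mul_eq_mul_div]
    simp [-ofReal_pow]
    ring
  have hAre : ∀ w, (A w).re ≤ 0 - m / 2 * ‖w‖ ^ 2 := by
    intro w
    rw [hre]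
    have := hc w
    nlinarith [sq_nonneg ‖w - a‖]
  set l : E →L[ℝ] ℂ := I • c.flip η - ofRealCLM ∘L innerSL ℝ η with hl
  have hlw : ∀ w, l w = I * c w η - (⟪η, w⟫_ℝ : ℝ) := fun w => by simp [hl]
  have hq : ∀ (w : E) (t : ℝ), A (w + t • η) = A w + t * l w +
      (t * ((⟪a, η⟫_ℝ : ℝ) + I * ‖η‖ ^ 2) + t ^ 2 * (-(1 / 2) * ‖η‖ ^ 2 + I / 2 * c η η)) := by
    intro w t
    have e1 : ‖w + t • η - a‖ ^ 2 = ‖w - a‖ ^ 2 + 2 * t * (⟪η, w⟫_ℝ - ⟪a, η⟫_ℝ) +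
        t ^ 2 * ‖η‖ ^ 2 := by
      rw [show w + t • η - a = (w - a) + t • η by abel, norm_add_sq_real, norm_smul, mul_pow,
        inner_smul_right, inner_sub_left, real_inner_comm η w, Real.norm_eq_abs, sq_abs]
      ring
    have e2 : ⟪η, w + t • η⟫_ℝ = ⟪η, w⟫_ℝ + t * ‖η‖ ^ 2 := by
      rw [inner_add_right, inner_smul_right, real_inner_self_eq_norm_sq]
    have e3 : c (w + t • η) (w + t • η) = c w w + 2 * t * c w η + t ^ 2 * c η η := by
      simp only [map_add, map_smul, _root_.add_apply, _root_.smul_apply, real_smul, hsymm η w]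
      ring
    simp only [hAdef, ← ofReal_pow]
    rw [e1, e2, e3, hlw]
    push_cast
    ring
  rw [gaussOverlap, integral_cexp_complex_shift hAc (half_pos hm) hAre l _ _ η hq (I * τ),
    norm_mul, norm_exp]
  have hηη : (c η η).im ≤ N * ‖η‖ ^ 2 := by
    refine (im_le_norm _).trans ((c.le_opNorm₂ η η).trans_eq ?_)
    ring
  have h1 : (I * τ * ((⟪a, η⟫_ℝ : ℝ) + I * ‖η‖ ^ 2) +
      (I * τ) ^ 2 * (-(1 / 2) * ‖η‖ ^ 2 + I / 2 * c η η)).re =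
      -τ * ‖η‖ ^ 2 + τ ^ 2 * (‖η‖ ^ 2 + (c η η).im) / 2 := by
    have : (I * τ * ((⟪a, η⟫_ℝ : ℝ) + I * ‖η‖ ^ 2) +
      (I * τ) ^ 2 * (-(1 / 2) * ‖η‖ ^ 2 + I / 2 * c η η)) =
      ((-τ * ‖η‖ ^ 2 + τ ^ 2 * ‖η‖ ^ 2 / 2 : ℝ) : ℂ) + I * ((τ * ⟪a, η⟫_ℝ : ℝ) : ℂ) -
        I * (((τ ^ 2 / 2 : ℝ) : ℂ) * c η η) := by
      push_cast
      ring_nf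
      simp only [I_sq, I_pow_three]
      ring
    rw [this, sub_re, add_re, ofReal_re, I_mul_re, I_mul_re, im_ofReal_mul, ofReal_im]
    ring
  have h2 : ∀ w, ‖cexp (A w + I * τ * l w)‖ ≤
      Real.exp (τ ^ 2 * N ^ 2 / m * ‖η‖ ^ 2 - k₁ / 2 * ‖a‖ ^ 2) *
        Real.exp (-(m / 8) * ‖w‖ ^ 2) := by
    intro w
    rw [norm_exp, ← Real.exp_add, Real.exp_le_exp, add_re, hre, hlw]
    have e1 : (I * τ * (I * c w η - (⟪η, w⟫_ℝ : ℝ))).re = -(τ * (c w η).re) := by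
      have : I * τ * (I * c w η - (⟪η, w⟫_ℝ : ℝ)) =
          -((τ : ℂ) * c w η) - I * ((τ * ⟪η, w⟫_ℝ : ℝ) : ℂ) := by
        push_cast
        ring_nf
        simp only [I_sq]
        ring
      rw [this, sub_re, neg_re, re_ofReal_mul, I_mul_re, ofReal_im]
      ring
    have e2 : -(c w η).re ≤ N * ‖w‖ * ‖η‖ :=
      (neg_le_abs _).trans ((abs_re_le_norm _).trans (c.le_opNorm₂ w η))
    have e3 : τ * (N * ‖w‖ * ‖η‖) ≤ m / 4 * ‖w‖ ^ 2 + τ ^ 2 * N ^ 2 / m * ‖η‖ ^ 2 := by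
      have e : m / 4 * ‖w‖ ^ 2 + τ ^ 2 * N ^ 2 / m * ‖η‖ ^ 2 - τ * (N * ‖w‖ * ‖η‖) =
          m * (‖w‖ / 2 - τ * N / m * ‖η‖) ^ 2 := by
        field_simp
        ring
      have : 0 ≤ m * (‖w‖ / 2 - τ * N / m * ‖η‖) ^ 2 := by positivity
      linarith
    have e4 : ‖a‖ ^ 2 ≤ 2 * ‖w - a‖ ^ 2 + 2 * ‖w‖ ^ 2 := by
      have : ‖a‖ ≤ ‖w‖ + ‖w - a‖ := by
        have := norm_sub_le w (w - a)
        simpa using this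
      nlinarith [sq_nonneg (‖w‖ - ‖w - a‖), norm_nonneg a]
    have e5 : k₁ * ‖w - a‖ ^ 2 ≤ 1 / 2 * ‖w - a‖ ^ 2 := by
      gcongr
      exact min_le_left _ _
    have e6 : k₁ * ‖w‖ ^ 2 ≤ m / 8 * ‖w‖ ^ 2 := by
      gcongr
      exact min_le_right _ _
    have e7 := mul_le_mul_of_nonneg_left e4 hk₁0.le
    have e8 := mul_le_mul_of_nonneg_left e2 hτ0.le
    have e9 := hc w
    rw [e1]
    linarith
  have h3 : ‖∫ w, cexp (A w + I * τ * l w)‖ ≤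
      Real.exp (τ ^ 2 * N ^ 2 / m * ‖η‖ ^ 2 - k₁ / 2 * ‖a‖ ^ 2) * K := by
    rw [hK, ← integral_const_mul]
    exact norm_integral_le_of_norm_le
      ((integrable_exp_neg_mul_sq_norm (by positivity)).const_mul _) (ae_of_all _ h2)
  rw [h1]
  refine (mul_le_mul_of_nonneg_left h3 (Real.exp_pos _).le).trans ?_
  rw [← mul_assoc, ← Real.exp_add, mul_comm]
  refine mul_le_mul (by linarith) (Real.exp_le_exp.2 ?_) (Real.exp_pos _).le (by linarith)
  have f1 : τ ^ 2 * (‖η‖ ^ 2 + (c η η).im) / 2 ≤ τ ^ 2 * ((1 + N) / 2) * ‖η‖ ^ 2 := by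
    have := mul_le_mul_of_nonneg_left hηη (sq_nonneg τ)
    linarith
  have f2 : τ ^ 2 * κ₀ = τ / 2 := by
    rw [hτ]
    field_simp
  have f3 : τ ^ 2 * ((1 + N) / 2) * ‖η‖ ^ 2 + τ ^ 2 * N ^ 2 / m * ‖η‖ ^ 2 = τ / 2 * ‖η‖ ^ 2 := by
    rw [← f2, hκ₀]
    ring
  have f4 : min (k₁ / 2) (τ / 2) * ‖a‖ ^ 2 ≤ k₁ / 2 * ‖a‖ ^ 2 := by
    gcongr
    exact min_le_left _ _
  have f5 : min (k₁ / 2) (τ / 2) * ‖η‖ ^ 2 ≤ τ / 2 * ‖η‖ ^ 2 := by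
    gcongr
    exact min_le_right _ _
  linarith

/-- Up to rescaling, `η ↦ gaussOverlap c 0 η` is the Fourier transform of a continuous integrable
function with value `1` at the origin. By Fourier inversion it cannot vanish identically; no complex
Gaussian integral has to be evaluated. -/
theorem exists_gaussOverlap_ne_zero (c : E →L[ℝ] E →L[ℝ] ℂ) {m : ℝ}
    (hm : 0 < m) (hc : ∀ w, m * ‖w‖ ^ 2 ≤ (c w w).im) : ∃ η : E, gaussOverlap c 0 η ≠ 0 := by
  by_contra! H
  set f : E → ℂ := fun w => cexp (-(1 / 2) * ‖w‖ ^ 2 + I / 2 * c w w) with hf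
  have hcc : Continuous fun w => c w w := c.continuous.clm_apply continuous_id
  have hfc : Continuous f := by fun_prop
  have hfi : Integrable f := by
    have := integrable_cexp_add_mul (E := E) (A := fun w => -(1 / 2) * ‖w‖ ^ 2 + I / 2 * c w w)
      (by fun_prop) (K := 0) (half_pos hm) (fun w => ?_) 0 0
    · simpa [hf] using this
    · have : ((-(1 / 2) * ‖w‖ ^ 2 + I / 2 * c w w : ℂ)).re =
          -(1 / 2) * ‖w‖ ^ 2 - (c w w).im / 2 := by
        simp only [← ofReal_pow, div_mul_eq_mul_div]
        simp [-ofReal_pow]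
        ring
      rw [this]
      nlinarith [hc w, sq_nonneg ‖w‖]
  have hF : 𝓕 f = 0 := by
    ext v
    rw [Real.fourier_eq', Pi.zero_apply, ← H ((-2 * Real.pi) • v), gaussOverlap]
    refine integral_congr_ae (ae_of_all _ fun w => ?_)
    simp only [hf, smul_eq_mul, ← Complex.exp_add, sub_zero]
    rw [inner_smul_left, real_inner_comm]
    congr 1
    simp [-ofReal_pow]
    ring
  have h0 := hfc.fourierInv_fourier_eq hfi (by rw [hF]; exact integrable_zero _ _ _)
  have h1 := congrFun h0 0
  rw [hF, Real.fourierInv_eq] at h1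
  simp [hf] at h1

end GaussianIntegrals

/-! ### Geometry of the FBI phase -/

namespace FBIPhase

open Complex
open scoped InnerProductSpace

variable {d : ℕ} (φ : FBIPhase d)

/-- The bilinear form `(v, w) ↦ ⟨Cv, w⟩` on `ℝ^d`. -/
def cform : RSpace d →L[ℝ] RSpace d →L[ℝ] ℂ :=
  ∑ i, ∑ j, (EuclideanSpace.proj j : RSpace d →L[ℝ] ℝ).smulRight
    (φ.C i j • (ofRealCLM ∘L (EuclideanSpace.proj i : RSpace d →L[ℝ] ℝ)))

theorem cform_apply (v w : RSpace d) :
    φ.cform v w = ∑ i, ∑ j, φ.C i j * (v j : ℂ) * (w i : ℂ) := by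
  have hpr : ∀ (i : Fin d) (v : RSpace d),
    (EuclideanSpace.proj i : RSpace d →L[ℝ] ℝ) v = v i := fun i v => rfl
  simp only [cform, sum_apply, ContinuousLinearMap.smulRight_apply, smul_apply, smul_eq_mul,
    real_smul, ContinuousLinearMap.comp_apply, ofRealCLM_apply, hpr]
  refine Finset.sum_congr rfl fun i _ => Finset.sum_congr rfl fun j _ => ?_
  ring

theorem cform_symm (v w : RSpace d) : φ.cform v w = φ.cform w v := by
  rw [cform_apply, cform_apply, Finset.sum_comm]
  refine Finset.sum_congr rfl fun i _ => Finset.sum_congr rfl fun j _ => ?_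
  rw [φ.symm_C.apply]
  ring

theorem eval_eq (z : CSpace d) (y : RSpace d) : φ.eval z y =
    (1 / 2) * ∑ i, ∑ j, φ.A i j * z j * z i + ∑ i, (∑ j, φ.B i j * z j) * (y i : ℂ)
      + (1 / 2) * φ.cform y y := by
  rw [eval, cform_apply]
  simp only [Finset.sum_mul]

/-- At `z = 0` the phase is purely quadratic, so in the lower bound of `im_eval_lower` the terms of
degree below two disappear under dilation. -/
theorem exists_le_im_cform : ∃ m : ℝ, 0 < m ∧ ∀ w, m * ‖w‖ ^ 2 ≤ (φ.cform w w).im := by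
  obtain ⟨c, a, b, hc, h⟩ := φ.im_eval_lower 0
  refine ⟨2 * c, by positivity, fun w => ?_⟩
  have h0 : ∀ y, (φ.eval 0 y).im = (φ.cform y y).im / 2 := by
    intro y
    rw [eval_eq]
    simp
    ring
  by_contra! hlt
  set D := c * ‖w‖ ^ 2 - (φ.cform w w).im / 2 with hD
  have hD0 : 0 < D := by linarith
  set S := |a| * ‖w‖ + |b| with hS
  have hS0 : 0 ≤ S := by positivity
  -- If `w` violates the bound by `D > 0`, the estimate at `t • w` yields `D t² ≤ S t`, whereas this
  -- `t` satisfies `D t = S + D > S`.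
  set t := S / D + 1 with ht
  have ht1 : 1 ≤ t := by
    have : 0 ≤ S / D := by positivity
    linarith
  have hDt : D * t = S + D := by
    rw [ht]
    field_simp
  have h1 := h (t • w)
  rw [h0, norm_smul, Real.norm_of_nonneg (by linarith)] at h1
  simp only [map_smul, smul_apply, real_smul, im_ofReal_mul] at h1
  have h2 : a * (t * ‖w‖) ≤ |a| * ‖w‖ * t := by
    have := mul_le_mul_of_nonneg_right (le_abs_self a) (by positivity : 0 ≤ t * ‖w‖)
    linarith
  have h3 : b ≤ |b| * t := (le_abs_self b).trans (le_mul_of_one_le_right (abs_nonneg b) ht1)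
  have h4 : D * t ^ 2 ≤ S * t := by
    rw [hD, hS]
    linarith
  have h5 : D * t ^ 2 = S * t + D * t := by
    have : D * t ^ 2 = (D * t) * t := by ring
    rw [this, hDt]
    linarith
  have : 0 < D * t := by positivity
  linarith

theorem sum_B_mul_chi (p : RSpace d × RSpace d) (i : Fin d) :
    ∑ j, φ.B i j * φ.chi p j = -((p.2 i : ℂ) + ∑ j, φ.C i j * (p.1 j : ℂ)) := by
  have hB : IsUnit φ.B.det := isUnit_iff_ne_zero.2 φ.det_B
  have h1 : φ.B *ᵥ (-(φ.B⁻¹ *ᵥ fun i => (p.2 i : ℂ) + ∑ j, φ.C i j * (p.1 j : ℂ))) =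
      -fun i => (p.2 i : ℂ) + ∑ j, φ.C i j * (p.1 j : ℂ) := by
    rw [Matrix.mulVec_neg, Matrix.mulVec_mulVec, Matrix.mul_nonsing_inv _ hB, Matrix.one_mulVec]
  exact congrFun h1 i

/-- The second order Taylor expansion of `φ(χ(x, ξ), ·)` at `x`. -/
theorem eval_chi_add (q : RSpace d × RSpace d) (w : RSpace d) :
    φ.eval (φ.chi q) (w + q.1) =
      φ.eval (φ.chi q) q.1 - (⟪q.2, w⟫_ℝ : ℝ) + (1 / 2) * φ.cform w w := by
  -- This is `Bz + Cx = -ξ` paired with `w`. The term `-⟨Cx, w⟩` cancels the cross term of the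
  -- quadratic part.
  have h : ∑ i, (∑ j, φ.B i j * φ.chi q j) * (w i : ℂ) =
      -(⟪q.2, w⟫_ℝ : ℝ) - φ.cform q.1 w := by
    simp only [sum_B_mul_chi, cform_apply, neg_mul, add_mul, Finset.sum_neg_distrib,
      Finset.sum_add_distrib, PiLp.inner_apply, Finset.sum_mul]
    push_cast
    simp only [RCLike.inner_apply, conj_trivial, ofReal_mul, mul_comm ((w _ : ℝ) : ℂ)]
    ring
  rw [eval_eq, eval_eq]
  simp only [PiLp.add_apply, ofReal_add, mul_add, Finset.sum_add_distrib, h, map_add,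
    _root_.add_apply, φ.cform_symm w q.1]
  ring

/-- In the expansion at the base point of `q` the linear term is real and the quadratic term has
nonnegative imaginary part, so that point attains the maximum defining `Φ`. -/
theorem weight_chi (q : RSpace d × RSpace d) :
    φ.weight (φ.chi q) = -(φ.eval (φ.chi q) q.1).im := by
  obtain ⟨m, hm, h⟩ := φ.exists_le_im_cform
  refine le_antisymm (ciSup_le fun y => ?_) (le_ciSup (φ.bddAbove_neg_im_eval _) q.1)
  have h1 := φ.eval_chi_add q (y - q.1)
  rw [sub_add_cancel] at h1
  have h2 := h (y - q.1)
  have h3 : 0 ≤ m * ‖y - q.1‖ ^ 2 := by positivity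
  have h4 : ((1 / 2 : ℂ) * φ.cform (y - q.1) (y - q.1)).im =
      (φ.cform (y - q.1) (y - q.1)).im / 2 := by
    simp
    ring
  rw [h1, add_im, sub_im, ofReal_im, h4]
  linarith

/-- The map `χ` as a real linear map. -/
def chiLinear : (RSpace d × RSpace d) →ₗ[ℝ] CSpace d where
  toFun := φ.chi
  map_add' p q := by
    simp only [chi, ← WithLp.toLp_add, ← neg_add, ← Matrix.mulVec_add]
    congr 3
    ext i
    simp [mul_add, Finset.sum_add_distrib]
    ring
  map_smul' t p := by
    simp only [chi, RingHom.id_apply, ← WithLp.toLp_smul, smul_neg, ← Matrix.mulVec_smul]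
    congr 3
    ext i
    simp [Finset.mul_sum, mul_left_comm]

/-- On the kernel `ξ = -Cx`, so `⟨Cx, x⟩ = -⟨ξ, x⟩` is real; positivity of `Im C` then forces `x =
0`, hence `ξ = 0`. -/
theorem chiLinear_injective : Function.Injective φ.chiLinear := by
  rw [← LinearMap.ker_eq_bot, LinearMap.ker_eq_bot']
  intro p hp
  have hz : φ.chi p = 0 := hp
  have h : ∀ i, (p.2 i : ℂ) + ∑ j, φ.C i j * (p.1 j : ℂ) = 0 := by
    intro i
    have := φ.sum_B_mul_chi p i
    rw [hz] at this
    exact neg_eq_zero.1 (this.symm.trans (by simp))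
  obtain ⟨m, hm, hc⟩ := φ.exists_le_im_cform
  have hx : p.1 = 0 := by
    have h1 : φ.cform p.1 p.1 = ((-∑ i, p.2 i * p.1 i : ℝ) : ℂ) := by
      rw [cform_apply]
      push_cast
      rw [← Finset.sum_neg_distrib]
      refine Finset.sum_congr rfl fun i _ => ?_
      rw [← Finset.sum_mul, eq_neg_of_add_eq_zero_right (h i)]
      ring
    have h2 := hc p.1
    rw [h1, ofReal_im] at h2
    have h3 : ‖p.1‖ ^ 2 ≤ 0 := by
      by_contra! h4
      have := mul_pos hm h4
      linarith
    simpa using le_antisymm h3 (sq_nonneg _)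
  refine Prod.ext hx ?_
  ext i
  have := h i
  rw [hx] at this
  simpa using this

/-- The map `χ` as a real linear homeomorphism of the phase space onto `ℂ^d`. -/
def chiEquiv : (RSpace d × RSpace d) ≃L[ℝ] CSpace d :=
  (LinearEquiv.ofInjectiveOfFinrankEq φ.chiLinear φ.chiLinear_injective (by
    rw [Module.finrank_prod, finrank_real_of_complex]
    simp [two_mul])).toContinuousLinearEquiv

theorem chiEquiv_apply (p : RSpace d × RSpace d) : φ.chiEquiv p = φ.chi p := rfl

theorem const_pos : 0 < φ.const := by
  have h1 := φ.posDef_im_C.det_pos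
  have h2 := norm_pos_iff.2 φ.det_B
  unfold const
  positivity

end FBIPhase

/-! ### Coherent states -/

section CoherentStates

open MeasureTheory Complex
open scoped InnerProductSpace

variable {d : ℕ}

/-- The Gaussian coherent state centred at the point `p = (x, ξ)` of the phase space. -/
def coherent (p : RSpace d × RSpace d) (y : RSpace d) : ℂ :=
  cexp (-(1 / 2) * ‖y - p.1‖ ^ 2 + I * (⟪p.2, y⟫_ℝ : ℝ))

/-- The bilinear pairing with a coherent state. -/
def coherentPairing (p : RSpace d × RSpace d) (f : RSpace d → ℂ) : ℂ :=
  ∫ y, coherent p y * f y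

theorem norm_coherent (p : RSpace d × RSpace d) (y : RSpace d) :
    ‖coherent p y‖ = Real.exp (-(1 / 2) * ‖y - p.1‖ ^ 2) := by
  have : (-(1 / 2) * ‖y - p.1‖ ^ 2 + I * (⟪p.2, y⟫_ℝ : ℝ) : ℂ) =
      ((-(1 / 2) * ‖y - p.1‖ ^ 2 : ℝ) : ℂ) + (⟪p.2, y⟫_ℝ : ℝ) * I := by
    push_cast
    ring
  rw [coherent, this, norm_exp]
  simp [-ofReal_mul, -ofReal_neg, -ofReal_pow]

theorem continuous_coherent (p : RSpace d × RSpace d) : Continuous (coherent p) := by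
  unfold coherent
  fun_prop

theorem fderiv_coherent (p : RSpace d × RSpace d) (y v : RSpace d) :
    fderiv ℝ (coherent p) y v =
      coherent p y * (-(⟪y - p.1, v⟫_ℝ : ℝ) + I * (⟪p.2, v⟫_ℝ : ℝ)) ∧
    DifferentiableAt ℝ (coherent p) y := by
  have h1 : HasFDerivAt (fun y : RSpace d => ‖y - p.1‖ ^ 2)
      (2 • innerSL ℝ (y - p.1)) y := by
    have := ((hasFDerivAt_id y).sub_const p.1).norm_sq
    simpa using this
  have h2 : HasFDerivAt (fun y : RSpace d => ⟪p.2, y⟫_ℝ) (innerSL ℝ p.2) y :=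
    (innerSL ℝ p.2).hasFDerivAt
  have h3 := (((ofRealCLM.hasFDerivAt.comp y h1).const_mul (-(1 / 2) : ℂ)).add
    ((ofRealCLM.hasFDerivAt.comp y h2).const_mul I)).cexp
  have h4 : coherent p = fun y => cexp ((-(1 / 2) : ℂ) * (ofRealCLM ∘ fun y => ‖y - p.1‖ ^ 2) y +
      I * (ofRealCLM ∘ fun y => ⟪p.2, y⟫_ℝ) y) := by
    ext y
    simp [coherent]
  refine ⟨?_, ?_⟩
  · rw [h4]
    refine (congrArg (fun L => L v) h3.fderiv).trans ?_
    rw [_root_.smul_apply, smul_eq_mul]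
    refine congrArg₂ (· * ·) rfl ?_
    simp only [_root_.add_apply, _root_.smul_apply, ContinuousLinearMap.comp_apply,
      innerSL_apply_apply, ofRealCLM_apply, smul_eq_mul, nsmul_eq_mul]
    push_cast
    ring
  · rw [h4]
    exact h3.differentiableAt

theorem integrable_one_add_norm_mul_exp :
    Integrable fun w : RSpace d => (1 + ‖w‖) * Real.exp (-(1 / 2) * ‖w‖ ^ 2) := by
  refine (integrable_exp_neg_mul_sq_norm_add_mul_norm (E := RSpace d) (k := 1 / 2) (by norm_num)
    1).mono' (by fun_prop) (ae_of_all _ fun w => ?_)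
  rw [Real.norm_of_nonneg (by positivity), one_mul, Real.exp_add, mul_comm]
  gcongr
  rw [add_comm]
  exact Real.add_one_le_exp _

/-- The weight `1 + ‖y - p.1‖` leaves room for the factor `y i - p.1 i`, which arises both from
recentring a monomial and from differentiating the Gaussian. -/
theorem norm_coherent_mul_le {p : RSpace d × RSpace d} {h : RSpace d → ℂ} {N : ℝ}
    (hN : ∀ y, ‖h y‖ ≤ N * (1 + ‖y - p.1‖)) (y : RSpace d) :
    ‖coherent p y * h y‖ ≤
      N * ((1 + ‖y - p.1‖) * Real.exp (-(1 / 2) * ‖y - p.1‖ ^ 2)) := by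
  rw [norm_mul, norm_coherent, ← mul_assoc, mul_comm]
  exact mul_le_mul_of_nonneg_right (hN y) (Real.exp_pos _).le

theorem integrable_coherent_mul (p : RSpace d × RSpace d) {h : RSpace d → ℂ} (hh : Continuous h)
    {N : ℝ} (hN : ∀ y, ‖h y‖ ≤ N * (1 + ‖y - p.1‖)) : Integrable fun y => coherent p y * h y :=
  ((integrable_one_add_norm_mul_exp.comp_sub_right p.1).const_mul N).mono'
    ((continuous_coherent p).mul hh).aestronglyMeasurable (ae_of_all _ (norm_coherent_mul_le hN))

theorem norm_coherentPairing_le (p : RSpace d × RSpace d) {h : RSpace d → ℂ}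
    {N : ℝ} (hN : ∀ y, ‖h y‖ ≤ N * (1 + ‖y - p.1‖)) : ‖coherentPairing p h‖ ≤
      N * ∫ w : RSpace d, (1 + ‖w‖) * Real.exp (-(1 / 2) * ‖w‖ ^ 2) := by
  rw [← integral_sub_right_eq_self _ p.1, ← integral_const_mul]
  exact norm_integral_le_of_norm_le
    ((integrable_one_add_norm_mul_exp.comp_sub_right p.1).const_mul N)
    (ae_of_all _ (norm_coherent_mul_le hN))

/-- Decay of the pairing with a coherent state as its centre moves to infinity. -/
theorem norm_mul_norm_coherentPairing_le (p : RSpace d × RSpace d) {f : RSpace d → ℂ}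
    (hf : ContDiff ℝ ∞ f) {N : ℝ} (h0 : ∀ y, ‖f y‖ ≤ N) (h1 : ∀ i y, ‖(y i : ℂ) * f y‖ ≤ N)
    (h2 : ∀ i y, ‖pderiv i f y‖ ≤ N) : ‖p‖ * ‖coherentPairing p f‖ ≤
      2 * d * (N * ∫ w : RSpace d, (1 + ‖w‖) * Real.exp (-(1 / 2) * ‖w‖ ^ 2)) := by
  set G := ∫ w : RSpace d, (1 + ‖w‖) * Real.exp (-(1 / 2) * ‖w‖ ^ 2)
  have hN0 : 0 ≤ N := (norm_nonneg _).trans (h0 0)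
  have hNle : ∀ y, N ≤ N * (1 + ‖y - p.1‖) := fun y =>
    le_mul_of_one_le_right hN0 (by linarith [norm_nonneg (y - p.1)])
  have hmul : ∀ i y, ‖((y i - p.1 i : ℝ) : ℂ) * f y‖ ≤ N * ‖y - p.1‖ := by
    intro i y
    rw [norm_mul, norm_real, mul_comm]
    exact mul_le_mul (h0 y) (PiLp.norm_apply_le (y - p.1) i) (norm_nonneg _) hN0
  have hx : ∀ i, |p.1 i| * ‖coherentPairing p f‖ ≤ N * G := by
    intro i
    have e : ((p.1 i : ℝ) : ℂ) * coherentPairing p f =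
        coherentPairing p fun y => ((p.1 i : ℝ) : ℂ) * f y := by
      simp only [coherentPairing, ← integral_const_mul]
      congr 1
      ext y
      ring
    rw [← Real.norm_eq_abs, ← norm_real, ← norm_mul, e]
    refine norm_coherentPairing_le p fun y => ?_
    have : ((p.1 i : ℝ) : ℂ) * f y = (y i : ℂ) * f y - ((y i - p.1 i : ℝ) : ℂ) * f y := by
      push_cast
      ring
    rw [this, mul_add, mul_one]
    exact (norm_sub_le _ _).trans (add_le_add (h1 i y) (hmul i y))
  have hξ : ∀ i, |p.2 i| * ‖coherentPairing p f‖ ≤ N * G := by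
    intro i
    set v : RSpace d := EuclideanSpace.single i 1 with hv
    have hder : ∀ y, fderiv ℝ (coherent p) y v =
        coherent p y * (-((y i - p.1 i : ℝ) : ℂ) + I * (p.2 i : ℂ)) := by
      intro y
      rw [(fderiv_coherent p y v).1]
      simp [hv, EuclideanSpace.inner_single_right]
    have hfc := hf.continuous
    have hdc : Continuous fun y => fderiv ℝ f y v := (contDiff_pderiv i hf).continuous
    have hyc : Continuous fun y : RSpace d => ((y i - p.1 i : ℝ) : ℂ) * f y := by fun_prop
    have i1 : Integrable fun y => coherent p y * f y :=
      integrable_coherent_mul p hfc fun y => (h0 y).trans (hNle y)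
    have i2 : Integrable fun y => coherent p y * fderiv ℝ f y v :=
      integrable_coherent_mul p hdc fun y => (h2 i y).trans (hNle y)
    have i3 : Integrable fun y => coherent p y * (((y i - p.1 i : ℝ) : ℂ) * f y) :=
      integrable_coherent_mul p hyc fun y => (hmul i y).trans (by nlinarith [norm_nonneg (y - p.1)])
    have e3 : ∀ y, fderiv ℝ (coherent p) y v * f y =
        I * (p.2 i : ℂ) * (coherent p y * f y) -
          coherent p y * (((y i - p.1 i : ℝ) : ℂ) * f y) := by
      intro y
      rw [hder]
      ring
    have ibp := integral_mul_fderiv_eq_neg_fderiv_mul_of_integrable (μ := volume)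
      (f := coherent p) (g := f) (v := v)
      (((i1.const_mul (I * (p.2 i : ℂ))).sub i3).congr (ae_of_all _ fun y => (e3 y).symm)) i2 i1
      (fun y _ => (fderiv_coherent p y v).2) fun y _ => (hf.differentiable (by simp)) y
    simp only [e3] at ibp
    rw [integral_sub (i1.const_mul _) i3, integral_const_mul] at ibp
    -- Multiplication of the coherent state by `iξ_i` equals `∂_i` plus multiplication by `y_i -
    -- x_i`; integration by parts moves `∂_i` onto `f`.
    have e : I * (p.2 i : ℂ) * coherentPairing p f =
        coherentPairing p fun y => ((y i - p.1 i : ℝ) : ℂ) * f y - fderiv ℝ f y v := by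
      simp only [coherentPairing, mul_sub]
      rw [integral_sub i3 i2, ibp]
      ring
    have e' : |p.2 i| * ‖coherentPairing p f‖ = ‖I * (p.2 i : ℂ) * coherentPairing p f‖ := by
      simp
    rw [e', e]
    refine norm_coherentPairing_le p fun y => ?_
    rw [mul_add, mul_one, add_comm]
    exact (norm_sub_le _ _).trans (add_le_add (hmul i y) (h2 i y))
  have hl1 : ∀ x : RSpace d, ‖x‖ ≤ ∑ i, |x i| := by
    intro x
    conv_lhs => rw [← (EuclideanSpace.basisFun (Fin d) ℝ).sum_repr x]
    refine (norm_sum_le _ _).trans (Finset.sum_le_sum fun i _ => ?_)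
    simp [norm_smul]
  -- The norm of the product is a maximum, dominated by the sum of the `2d` absolute coordinates;
  -- hence the factor `2 * d`.
  have hp : ‖p‖ ≤ ∑ i, |p.1 i| + ∑ i, |p.2 i| :=
    (norm_prod_le_iff.2 ⟨(hl1 p.1).trans (le_add_of_nonneg_right (by positivity)),
      (hl1 p.2).trans (le_add_of_nonneg_left (by positivity))⟩)
  calc _ ≤ (∑ i, |p.1 i| + ∑ i, |p.2 i|) * ‖coherentPairing p f‖ := by gcongr
    _ = ∑ i, |p.1 i| * ‖coherentPairing p f‖ + ∑ i, |p.2 i| * ‖coherentPairing p f‖ := by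
        rw [add_mul, Finset.sum_mul, Finset.sum_mul]
    _ ≤ ∑ _i : Fin d, N * G + ∑ _i : Fin d, N * G :=
        add_le_add (Finset.sum_le_sum fun i _ => hx i) (Finset.sum_le_sum fun i _ => hξ i)
    _ = _ := by
        simp
        ring

/-- After translation by `q.1`, the exact Taylor expansion of the phase splits off a constant factor
of modulus `e^{Φ(χ(q))}` and leaves an integral depending only on `p - q`. -/
theorem norm_coherentPairing_kernel (φ : FBIPhase d) (p q : RSpace d × RSpace d) :
    ‖coherentPairing p (φ.kernel (φ.chi q))‖ = Real.exp (φ.weight (φ.chi q)) *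
      ‖gaussOverlap φ.cform (p.1 - q.1) (p.2 - q.2)‖ := by
  have h : coherentPairing p (φ.kernel (φ.chi q)) =
      cexp (I * (⟪p.2, q.1⟫_ℝ : ℝ) + I * φ.eval (φ.chi q) q.1) *
        gaussOverlap φ.cform (p.1 - q.1) (p.2 - q.2) := by
    rw [coherentPairing, gaussOverlap, ← integral_const_mul,
      ← integral_add_right_eq_self _ q.1]
    refine integral_congr_ae (ae_of_all _ fun w => ?_)
    simp only [coherent, FBIPhase.kernel, ← Complex.exp_add]
    rw [φ.eval_chi_add, show w + q.1 - p.1 = w - (p.1 - q.1) by abel, inner_add_right,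
      inner_sub_left]
    congr 1
    push_cast
    ring
  rw [h, norm_mul, norm_exp, φ.weight_chi]
  simp

end CoherentStates

/-! ### Sums of coherent states -/

section CoherentSums

open MeasureTheory Filter Topology

variable {d : ℕ} {θ : ℝ}

theorem partialDeriv_zero (f : RSpace d → ℂ) : partialDeriv 0 f = f := by
  unfold partialDeriv
  induction List.finRange d with
  | nil => rfl
  | cons i l ih => simp

theorem partialDeriv_single (i : Fin d) (f : RSpace d → ℂ) :
    partialDeriv (Pi.single i 1) f = pderiv i f := by
  have h0 : ∀ l : List (Fin d), i ∉ l →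
      l.foldr (fun j g => (pderiv j)^[(Pi.single i 1 : Fin d → ℕ) j] g) f = f := by
    intro l
    induction l with
    | nil => exact fun _ => rfl
    | cons j l ih =>
      intro h
      rw [List.mem_cons, not_or] at h
      rw [List.foldr_cons, ih h.2, Pi.single_eq_of_ne (Ne.symm h.1), Function.iterate_zero, id]
  have h1 : ∀ l : List (Fin d), l.Nodup → i ∈ l →
      l.foldr (fun j g => (pderiv j)^[(Pi.single i 1 : Fin d → ℕ) j] g) f = pderiv i f := by
    intro l
    induction l with
    | nil => exact fun _ h => absurd h List.not_mem_nil
    | cons j l ih =>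
      intro hn h
      rw [List.nodup_cons] at hn
      rw [List.foldr_cons]
      rcases eq_or_ne i j with rfl | hij
      · rw [h0 l hn.1, Pi.single_eq_same, Function.iterate_one]
      · rw [ih hn.2 ((List.mem_cons.1 h).resolve_left hij), Pi.single_eq_of_ne hij.symm,
          Function.iterate_zero, id]
  exact h1 _ (List.nodup_finRange d) (List.mem_finRange i)

/-- Only multi-indices of length at most one enter. Their factorials are `1`, so `θ` drops out, and
the powers `1` and `ε` are both at most `1 + ε`. -/
theorem bounds_of_gsNorm_le {ε : ℝ} (hε : 0 < ε) {f : RSpace d → ℂ} {M : ℝ} (hM : 0 ≤ M)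
    (h : gsNorm θ ε f ≤ ENNReal.ofReal M) : (∀ y, ‖f y‖ ≤ M * (1 + ε)) ∧
      (∀ i y, ‖(y i : ℂ) * f y‖ ≤ M * (1 + ε)) ∧ ∀ i y, ‖pderiv i f y‖ ≤ M * (1 + ε) := by
  rw [gsNorm_le_iff hε hM] at h
  have d0 : mdeg (0 : Fin d → ℕ) = 0 := by simp [mdeg]
  have f0 : mfact (0 : Fin d → ℕ) = 1 := by simp [mfact]
  have m0 : ∀ y : RSpace d, monom 0 y = 1 := fun y => by simp [monom]
  have d1 : ∀ i : Fin d, mdeg (Pi.single i 1 : Fin d → ℕ) = 1 := fun i => by simp [mdeg]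
  have f1 : ∀ i : Fin d, mfact (Pi.single i 1 : Fin d → ℕ) = 1 := fun i =>
    Finset.prod_eq_one fun j _ => by
      rcases eq_or_ne j i with rfl | hj
      · simp
      · simp [hj]
  have m1 : ∀ (i : Fin d) (y : RSpace d), monom (Pi.single i 1) y = y i := fun i y => by
    unfold monom
    rw [Finset.prod_eq_single i]
    · simp
    · intro j _ hj
      simp [hj]
    · simp
  refine ⟨fun y => ?_, fun i y => ?_, fun i y => ?_⟩
  · have := h 0 0 y
    simp only [partialDeriv_zero, d0, f0, m0] at this
    simp at this
    nlinarith
  · have := h (Pi.single i 1) 0 y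
    simp only [partialDeriv_zero, d0, f0, m1, d1, f1] at this
    simp at this
    rw [norm_mul]
    simp
    nlinarith
  · have := h 0 (Pi.single i 1) y
    simp only [partialDeriv_single, d0, f0, m0, d1, f1] at this
    simp at this
    nlinarith

/-- The constant in the bound of the pairing with a coherent state. -/
def coherentConst (d : ℕ) : ℝ :=
  2 * d * ∫ w : RSpace d, (1 + ‖w‖) * Real.exp (-(1 / 2) * ‖w‖ ^ 2)

theorem coherentConst_nonneg (d : ℕ) : 0 ≤ coherentConst d := by
  have : 0 ≤ ∫ w : RSpace d, (1 + ‖w‖) * Real.exp (-(1 / 2) * ‖w‖ ^ 2) :=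
    integral_nonneg fun w => by positivity
  unfold coherentConst
  positivity

/-- One power of decay in `‖p‖` suffices because the centres grow geometrically. -/
theorem norm_coherentPairing_le_geometric {ε : ℝ} (hε : 0 < ε) {f : RSpace d → ℂ}
    (hf : ContDiff ℝ ∞ f) {M : ℝ} (hM : 0 ≤ M) (h : gsNorm θ ε f ≤ ENNReal.ofReal M)
    {p : ℕ → RSpace d × RSpace d} (hp : ∀ k, ‖p k‖ = 2 ^ k) (k : ℕ) :
    ‖coherentPairing (p k) f‖ ≤ coherentConst d * (M * (1 + ε)) * (1 / 2) ^ k := by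
  obtain ⟨h0, h1, h2⟩ := bounds_of_gsNorm_le hε hM h
  have := norm_mul_norm_coherentPairing_le (p k) hf h0 h1 h2
  rw [hp] at this
  rw [one_div, inv_pow, ← div_eq_mul_inv, le_div_iff₀ (by positivity), coherentConst]
  linarith

theorem exists_gsNorm_le (f : GS θ d) : ∃ ε M : ℝ, 0 < ε ∧ 0 ≤ M ∧
    gsNorm θ ε (f : RSpace d → ℂ) ≤ ENNReal.ofReal M := by
  obtain ⟨ε, hε, h⟩ := f.2.2
  exact ⟨ε, _, hε, ENNReal.toReal_nonneg, (ENNReal.ofReal_toReal h.ne).ge⟩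

theorem summable_coherentPairing {p : ℕ → RSpace d × RSpace d} (hp : ∀ k, ‖p k‖ = 2 ^ k)
    (f : GS θ d) : Summable fun k => coherentPairing (p k) f := by
  obtain ⟨ε, M, hε, hM, h⟩ := exists_gsNorm_le f
  exact Summable.of_norm_bounded (summable_geometric_two.mul_left _)
    (norm_coherentPairing_le_geometric hε f.2.1 hM h hp)

theorem integrable_coherent_mul_GS (p : RSpace d × RSpace d) (f : GS θ d) :
    Integrable fun y => coherent p y * (f : RSpace d → ℂ) y := by
  obtain ⟨ε, M, hε, hM, h⟩ := exists_gsNorm_le f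
  refine integrable_coherent_mul p f.2.1.continuous (N := M * (1 + ε)) fun y =>
    ((bounds_of_gsNorm_le hε hM h).1 y).trans (le_mul_of_one_le_right (by positivity) ?_)
  linarith [norm_nonneg (y - p.1)]

theorem coherentPairing_add (p : RSpace d × RSpace d) (f g : GS θ d) :
    coherentPairing p (f + g : GS θ d) = coherentPairing p f + coherentPairing p g := by
  unfold coherentPairing
  rw [← integral_add (integrable_coherent_mul_GS p f) (integrable_coherent_mul_GS p g)]
  simp [mul_add]

theorem coherentPairing_smul (p : RSpace d × RSpace d) (c : ℂ) (f : GS θ d) :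
    coherentPairing p (c • f : GS θ d) = c * coherentPairing p f := by
  unfold coherentPairing
  rw [← integral_const_mul]
  simp [mul_left_comm]

/-- The sum of the coherent states centred at the points of a sparse sequence. -/
def coherentSum (θ : ℝ) (p : ℕ → RSpace d × RSpace d) (hp : ∀ k, ‖p k‖ = 2 ^ k) : GSDual θ d where
  toLinearMap :=
    { toFun := fun f => ∑' k, coherentPairing (p k) f
      map_add' := fun f g => by
        simp only [coherentPairing_add]
        exact (summable_coherentPairing hp f).tsum_add (summable_coherentPairing hp g)
      map_smul' := fun c f => by
        simp only [coherentPairing_smul, tsum_mul_left, RingHom.id_apply, smul_eq_mul] }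
  bound := by
    intro ε hε
    have hD := coherentConst_nonneg d
    -- The factor `2` sums the geometric series. The `+ 1` makes the constant strictly positive, so
    -- the bound also holds when the norm is infinite.
    refine ⟨coherentConst d * (1 + ε) * 2 + 1, by positivity, fun f => ?_⟩
    rcases eq_or_ne (gsNorm θ ε (f : RSpace d → ℂ)) ⊤ with htop | htop
    · rw [htop, ENNReal.mul_top]
      · exact le_top
      · exact (ENNReal.ofReal_pos.2 (by positivity)).ne'
    · set M := (gsNorm θ ε (f : RSpace d → ℂ)).toReal with hM
      have hM0 : 0 ≤ M := ENNReal.toReal_nonneg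
      have h := norm_coherentPairing_le_geometric (p := p) hε f.2.1 hM0
        (ENNReal.ofReal_toReal htop).ge hp
      have hs := summable_geometric_two.mul_left (coherentConst d * (M * (1 + ε)))
      have h2 := tsum_of_norm_bounded hs.hasSum h
      rw [tsum_mul_left, tsum_geometric_two] at h2
      rw [← ENNReal.ofReal_toReal htop, ← ENNReal.ofReal_mul (by positivity)]
      refine ENNReal.ofReal_le_ofReal (h2.trans ?_)
      rw [← hM]
      linarith

theorem norm_fbi_coherentSum (hθ : 1 / 2 ≤ θ) (φ : FBIPhase d) {p : ℕ → RSpace d × RSpace d}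
    (hp : ∀ k, ‖p k‖ = 2 ^ k) (z : CSpace d) : ‖fbi hθ φ (coherentSum θ p hp) z‖ =
      φ.const * ‖∑' k, coherentPairing (p k) (φ.kernel z)‖ := by
  unfold fbi
  rw [norm_mul, Complex.norm_real, Real.norm_of_nonneg φ.const_pos.le]
  rfl

theorem exists_norm_coherentPairing_kernel_le (φ : FBIPhase d) : ∃ K k : ℝ, 0 < K ∧ 0 < k ∧
    ∀ p q : RSpace d × RSpace d, ‖coherentPairing p (φ.kernel (φ.chi q))‖ ≤
      Real.exp (φ.weight (φ.chi q)) * (K * Real.exp (-k * ‖p - q‖ ^ 2)) := by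
  obtain ⟨m, hm, hc⟩ := φ.exists_le_im_cform
  obtain ⟨K, k, hK, hk, h⟩ := exists_gaussOverlap_le φ.cform φ.cform_symm hm hc
  refine ⟨K, k, hK, hk, fun p q => ?_⟩
  rw [norm_coherentPairing_kernel]
  refine mul_le_mul_of_nonneg_left ((h _ _).trans ?_) (Real.exp_pos _).le
  refine mul_le_mul_of_nonneg_left (Real.exp_le_exp.2 ?_) hK.le
  have : ‖p - q‖ ^ 2 ≤ ‖p.1 - q.1‖ ^ 2 + ‖p.2 - q.2‖ ^ 2 := by
    rw [Prod.norm_def]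
    rcases max_choice ‖(p - q).1‖ ‖(p - q).2‖ with h | h <;> rw [h]
    · exact le_add_of_nonneg_right (sq_nonneg _)
    · exact le_add_of_nonneg_left (sq_nonneg _)
  have := mul_le_mul_of_nonneg_left this hk.le
  linarith

theorem summable_exp_neg_mul_four_pow {c : ℝ} (hc : 0 < c) :
    Summable fun j : ℕ => Real.exp (-c * 4 ^ j) := by
  refine Summable.of_nonneg_of_le (fun j => (Real.exp_pos _).le) (fun j => Real.exp_le_exp.2 ?_)
    (Real.summable_exp_nat_mul_iff.2 (neg_lt_zero.2 hc))
  have : (j : ℝ) ≤ 4 ^ j := by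
    exact_mod_cast (Nat.lt_pow_self (by norm_num : 1 < 4)).le
  nlinarith

/-- The FBI transform of a sum of coherent states has Gaussian decay away from their centres. -/
theorem exists_norm_fbi_coherentSum_le (hθ : 1 / 2 ≤ θ) (φ : FBIPhase d)
    {p : ℕ → RSpace d × RSpace d} (hp : ∀ k, ‖p k‖ = 2 ^ k) {δ : ℝ} (hδ : 0 < δ) :
    ∃ K k : ℝ, 0 < K ∧ 0 < k ∧ ∀ q, (∀ j, δ * ‖q‖ ≤ ‖p j - q‖) →
      ‖fbi hθ φ (coherentSum θ p hp) (φ.chi q)‖ ≤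
        K * Real.exp (-k * ‖q‖ ^ 2 + φ.weight (φ.chi q)) := by
  obtain ⟨K, k, hK, hk, h⟩ := exists_norm_coherentPairing_kernel_le φ
  -- With `D = ‖p j - q‖` one has `‖q‖ ≤ D / δ` and `2 ^ j = ‖p j‖ ≤ D + ‖q‖ ≤ (1 + 1 / δ) D`. Hence
  -- `‖q‖² + 4 ^ j ≤ a D²`: the same Gaussian provides decay in `q` and summability in `j`.
  set a := (1 / δ) ^ 2 + (1 + 1 / δ) ^ 2 with ha
  have ha0 : 0 < a := by positivity
  set c := k / a with hc
  have hc0 : 0 < c := by positivity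
  set S := ∑' j : ℕ, Real.exp (-c * 4 ^ j) with hS
  have hS0 : 0 ≤ S := tsum_nonneg fun j => (Real.exp_pos _).le
  have hφ := φ.const_pos
  refine ⟨φ.const * (K * (S + 1)), c, by positivity, hc0, fun q hq => ?_⟩
  have hb : ∀ j, ‖coherentPairing (p j) (φ.kernel (φ.chi q))‖ ≤
      K * Real.exp (-c * ‖q‖ ^ 2 + φ.weight (φ.chi q)) * Real.exp (-c * 4 ^ j) := by
    intro j
    refine (h (p j) q).trans ?_
    rw [mul_left_comm, ← Real.exp_add, mul_assoc, ← Real.exp_add]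
    refine mul_le_mul_of_nonneg_left (Real.exp_le_exp.2 ?_) hK.le
    set D := ‖p j - q‖ with hD
    have h1 : ‖q‖ ≤ 1 / δ * D := by
      rw [one_div, le_inv_mul_iff₀ hδ]
      exact hq j
    have h2 : (2 : ℝ) ^ j ≤ (1 + 1 / δ) * D := by
      have : ‖p j‖ ≤ D + ‖q‖ := by simpa using norm_add_le (p j - q) q
      rw [hp] at this
      linarith
    have h3 := pow_le_pow_left₀ (norm_nonneg q) h1 2
    have h4 := pow_le_pow_left₀ (by positivity) h2 2
    rw [← pow_mul, mul_comm j 2, pow_mul, show (2 : ℝ) ^ 2 = 4 by norm_num] at h4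
    have h5 : c * (‖q‖ ^ 2 + 4 ^ j) ≤ k * D ^ 2 := by
      have e : k * D ^ 2 = c * (a * D ^ 2) := by
        rw [hc]
        field_simp
      rw [e]
      refine mul_le_mul_of_nonneg_left ?_ hc0.le
      rw [ha, add_mul, ← mul_pow, ← mul_pow]
      exact add_le_add h3 h4
    linarith
  have hs := (summable_exp_neg_mul_four_pow hc0).mul_left
    (K * Real.exp (-c * ‖q‖ ^ 2 + φ.weight (φ.chi q)))
  have h2 := tsum_of_norm_bounded hs.hasSum hb
  rw [tsum_mul_left, ← hS] at h2
  rw [norm_fbi_coherentSum, mul_assoc]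
  refine mul_le_mul_of_nonneg_left (h2.trans ?_) hφ.le
  have : 0 ≤ K * Real.exp (-c * ‖q‖ ^ 2 + φ.weight (φ.chi q)) := by positivity
  linarith

/-- The larger power is at least twice the smaller, so the difference is at least half the larger,
hence at least a quarter of the sum. -/
theorem quarter_mul_le_abs_two_pow_sub {j k : ℕ} (h : j ≠ k) :
    1 / 4 * ((2 : ℝ) ^ j + 2 ^ k) ≤ |(2 : ℝ) ^ j - 2 ^ k| := by
  rcases lt_or_gt_of_ne h with h | h
  · have h1 : (2 : ℝ) ^ (j + 1) ≤ 2 ^ k := pow_le_pow_right₀ (by norm_num) h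
    rw [pow_succ] at h1
    have h2 : (0 : ℝ) < 2 ^ j := by positivity
    rw [abs_of_nonpos (by linarith)]
    linarith
  · have h1 : (2 : ℝ) ^ (k + 1) ≤ 2 ^ j := pow_le_pow_right₀ (by norm_num) h
    rw [pow_succ] at h1
    have h2 : (0 : ℝ) < 2 ^ k := by positivity
    rw [abs_of_nonneg (by linarith)]
    linarith

/-- The FBI transform of a sum of coherent states does not decay along a translate of the sequence
of their centres. -/
theorem exists_le_norm_fbi_coherentSum (hθ : 1 / 2 ≤ θ) (φ : FBIPhase d)
    {p : ℕ → RSpace d × RSpace d} (hp : ∀ k, ‖p k‖ = 2 ^ k) :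
    ∃ (r : RSpace d × RSpace d) (v : ℝ), 0 < v ∧ ∀ᶠ k in atTop,
      v * Real.exp (φ.weight (φ.chi (p k - r))) ≤
        ‖fbi hθ φ (coherentSum θ p hp) (φ.chi (p k - r))‖ := by
  obtain ⟨m, hm, hcm⟩ := φ.exists_le_im_cform
  obtain ⟨η, hη⟩ := exists_gaussOverlap_ne_zero φ.cform hm hcm
  obtain ⟨K, k₀, hK, hk₀, h⟩ := exists_norm_coherentPairing_kernel_le φ
  -- At `p k - r` the overlap of the `k`-th term is `gaussOverlap φ.cform 0 η`, the same nonzero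
  -- number for every `k`.
  set r : RSpace d × RSpace d := (0, η) with hr
  set v₀ := ‖gaussOverlap φ.cform 0 η‖ with hv₀
  have hv₀0 : 0 < v₀ := norm_pos_iff.2 hη
  have hφ := φ.const_pos
  -- For `j ≠ k`, `(4 ^ j + 4 ^ k) / 16 ≤ (D + ‖r‖)² ≤ 2 D² + 2 ‖r‖²` with `D = ‖p j - q‖`. The term
  -- in `r` is paid for by the exponential in `K'`.
  set c := k₀ / 32 with hc
  have hc0 : 0 < c := by positivity
  set S := ∑' j : ℕ, Real.exp (-c * 4 ^ j) with hS
  set K' := K * Real.exp (k₀ * ‖r‖ ^ 2) with hK'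
  have hlim : Tendsto (fun k : ℕ => K' * S * Real.exp (-c * 4 ^ k)) atTop (𝓝 0) := by
    have := (summable_exp_neg_mul_four_pow hc0).tendsto_atTop_zero.const_mul (K' * S)
    simpa using this
  refine ⟨r, φ.const * (v₀ / 2), by positivity, ?_⟩
  filter_upwards [hlim.eventually_le_const (half_pos hv₀0)] with k hk
  set q := p k - r with hq
  set W := Real.exp (φ.weight (φ.chi q)) with hW
  have hW0 : 0 < W := Real.exp_pos _
  have hb : ∀ j, ‖if j = k then 0 else coherentPairing (p j) (φ.kernel (φ.chi q))‖ ≤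
      W * K' * Real.exp (-c * 4 ^ k) * Real.exp (-c * 4 ^ j) := by
    intro j
    split_ifs with hjk
    · rw [norm_zero]
      positivity
    · refine (h (p j) q).trans ?_
      rw [hK', mul_assoc, mul_assoc, mul_assoc, ← Real.exp_add, ← Real.exp_add]
      refine mul_le_mul_of_nonneg_left (mul_le_mul_of_nonneg_left (Real.exp_le_exp.2 ?_) hK.le)
        hW0.le
      set D := ‖p j - q‖ with hD
      have h1 : |(2 : ℝ) ^ j - 2 ^ k| ≤ D + ‖r‖ := by
        have e1 : |‖p j‖ - ‖p k‖| ≤ ‖p j - p k‖ := abs_norm_sub_norm_le _ _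
        have e2 : ‖p j - p k‖ ≤ D + ‖r‖ := by
          have : p j - p k = (p j - q) - r := by
            rw [hq]
            abel
          rw [this]
          exact norm_sub_le _ _
        rw [hp, hp] at e1
        exact e1.trans e2
      have h2 := (quarter_mul_le_abs_two_pow_sub hjk).trans h1
      have h3 := pow_le_pow_left₀ (by positivity) h2 2
      have h4 : ∀ i : ℕ, ((2 : ℝ) ^ i) ^ 2 = 4 ^ i := by
        intro i
        rw [← pow_mul, mul_comm i 2, pow_mul]
        norm_num
      have h5 : ((4 : ℝ) ^ j + 4 ^ k) / 32 ≤ D ^ 2 + ‖r‖ ^ 2 := by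
        have h6 : (0 : ℝ) < 2 ^ j * 2 ^ k := by positivity
        rw [← h4 j, ← h4 k]
        nlinarith [sq_nonneg (D - ‖r‖)]
      have h6 := mul_le_mul_of_nonneg_left h5 hk₀.le
      rw [hc]
      linarith
  have hs := (summable_exp_neg_mul_four_pow hc0).mul_left (W * K' * Real.exp (-c * 4 ^ k))
  have h2 := tsum_of_norm_bounded hs.hasSum hb
  rw [tsum_mul_left, ← hS] at h2
  have hsum : Summable fun j => coherentPairing (p j) (φ.kernel (φ.chi q)) :=
    summable_coherentPairing hp (⟨φ.kernel (φ.chi q), φ.kernel_mem hθ _⟩ : GS θ d)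
  have hmain : ‖coherentPairing (p k) (φ.kernel (φ.chi q))‖ = W * v₀ := by
    rw [norm_coherentPairing_kernel, hv₀, hq]
    simp [hr, hW, hq]
  rw [norm_fbi_coherentSum, hsum.tsum_eq_add_tsum_ite k, mul_assoc]
  refine mul_le_mul_of_nonneg_left ?_ hφ.le
  have h3 := norm_sub_le_norm_add (coherentPairing (p k) (φ.kernel (φ.chi q)))
    (∑' j, if j = k then 0 else coherentPairing (p j) (φ.kernel (φ.chi q)))
  rw [hmain] at h3
  have h4 := mul_le_mul_of_nonneg_left hk hW0.le
  linarith

end CoherentSums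

/-! ### Wave front sets -/

section WaveFrontSets

open Filter Topology

variable {d : ℕ} {θ : ℝ}

/-- Since `θ ≥ 1/2` means `1 / θ ≤ 2`, Gaussian decay implies the decay required off the wave front
set. The summand `1` handles `t ≤ 1`. -/
theorem rpow_inv_le_one_add_sq (hθ : 1 / 2 ≤ θ) {t : ℝ} (ht : 0 ≤ t) :
    t ^ (1 / θ) ≤ 1 + t ^ 2 := by
  have hθ0 : 0 < θ := by linarith
  rcases le_total t 1 with h | h
  · have := Real.rpow_le_one ht h (by positivity : 0 ≤ 1 / θ)
    have := sq_nonneg t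
    linarith
  · have h1 : 1 / θ ≤ 2 := by
      rw [div_le_iff₀ hθ0]
      linarith
    have := Real.rpow_le_rpow_of_exponent_le h h1
    rw [Real.rpow_two] at this
    linarith

/-- A sparse sequence in a conic set that visits every direction of a dense set infinitely often. -/
theorem exists_sparse_sequence {V : Type*} [NormedAddCommGroup V] [NormedSpace ℝ V]
    [SecondCountableTopology V] {Γ : Set V} (h0 : (0 : V) ∉ Γ) (hΓ : IsConic Γ)
    (hne : Γ.Nonempty) : ∃ p : ℕ → V, (∀ k, p k ∈ Γ) ∧ (∀ k, ‖p k‖ = 2 ^ k) ∧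
      ∀ U : Set V, IsOpen U → IsConic U → (U ∩ Γ).Nonempty →
        ∃ b ∈ U, ∃ᶠ k in atTop, p k = (2 : ℝ) ^ k • b := by
  have : Nonempty Γ := hne.to_subtype
  set a : ℕ → Γ := TopologicalSpace.denseSeq Γ with ha
  have hna : ∀ j, 0 < ‖(a j : V)‖ := fun j =>
    norm_pos_iff.2 fun h => h0 (h ▸ (a j).2)
  set b : ℕ → V := fun j => ‖(a j : V)‖⁻¹ • (a j : V) with hb
  -- The first component of `Nat.unpair` takes every value infinitely often: `Nat.pair j n ≥ n` has
  -- first component `j` for all `n`.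
  refine ⟨fun k => (2 : ℝ) ^ k • b k.unpair.1, fun k => ?_, fun k => ?_, fun U hU hUc hUΓ => ?_⟩
  · exact hΓ _ (by positivity) _ (hΓ _ (inv_pos.2 (hna _)) _ (a _).2)
  · rw [norm_smul, hb, norm_smul, norm_inv, norm_norm, inv_mul_cancel₀ (hna _).ne', mul_one]
    simp
  · obtain ⟨x, hxU, hxΓ⟩ := hUΓ
    obtain ⟨j, hj⟩ := (TopologicalSpace.denseRange_denseSeq Γ).exists_mem_open
      (hU.preimage continuous_subtype_val) ⟨⟨x, hxΓ⟩, hxU⟩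
    refine ⟨b j, hUc _ (inv_pos.2 (hna _)) _ hj, ?_⟩
    rw [frequently_atTop]
    intro n
    exact ⟨Nat.pair j n, Nat.right_le_pair j n, by simp⟩

/-- The distance to a cone is homogeneous of degree one, so `δ ‖q‖ < infDist q Γ` cuts out an open
cone, on which every centre is at distance at least `δ ‖q‖` from `q`. The image of this cone under
`χ` serves as `L`. -/
theorem WF_coherentSum_subset (hθ : 1 / 2 ≤ θ) {Γ : Set (RSpace d × RSpace d)}
    (hΓ0 : (0 : RSpace d × RSpace d) ∉ Γ) (hne : Γ.Nonempty)
    (hΓclosed : IsClosed {p : {q : RSpace d × RSpace d // q ≠ 0} | p.1 ∈ Γ})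
    (hΓ : IsConic Γ) {p : ℕ → RSpace d × RSpace d} (hp : ∀ k, ‖p k‖ = 2 ^ k)
    (hpΓ : ∀ k, p k ∈ Γ) (φ : FBIPhase d) : WF hθ φ (coherentSum θ p hp) ⊆ Γ := by
  rintro x ⟨hx0, hx⟩
  by_contra hxΓ
  refine hx ?_
  -- Relative closedness means that the closure in the whole space can add only the origin, and `x ≠
  -- 0`.
  have hxcl : x ∉ closure Γ := by
    obtain ⟨t, ht, hteq⟩ := isClosed_induced_iff.1 hΓclosed
    have hmem : ∀ y, y ≠ 0 → (y ∈ t ↔ y ∈ Γ) := fun y hy =>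
      Set.ext_iff.1 hteq ⟨y, hy⟩
    have hsub : Γ ⊆ t := fun y hy => (hmem y fun h => hΓ0 (h ▸ hy)).2 hy
    exact fun h => hxΓ ((hmem x hx0).1 (closure_minimal hsub ht h))
  have hd0 : 0 < Metric.infDist x Γ := Metric.infDist_nonneg.lt_of_ne fun h =>
    hxcl ((Metric.mem_closure_iff_infDist_zero hne).2 h.symm)
  have hxn : 0 < ‖x‖ := norm_pos_iff.2 hx0
  set δ := Metric.infDist x Γ / (2 * ‖x‖) with hδ
  have hδ0 : 0 < δ := by positivity
  set U : Set (RSpace d × RSpace d) := {q | q ≠ 0 ∧ δ * ‖q‖ < Metric.infDist q Γ} with hU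
  have hUo : IsOpen U := isOpen_ne.inter
    (isOpen_lt (by fun_prop) (Metric.continuous_infDist_pt Γ))
  have hUc : IsConic U := by
    rintro t ht q ⟨hq0, hq⟩
    refine ⟨smul_ne_zero ht.ne' hq0, ?_⟩
    have h1 : t * Metric.infDist q Γ ≤ Metric.infDist (t • q) Γ := by
      refine (Metric.le_infDist hne).2 fun y hy => ?_
      have h2 := Metric.infDist_le_dist_of_mem (x := q) (hΓ t⁻¹ (inv_pos.2 ht) y hy)
      have h3 : dist (t • q) y = t * dist q (t⁻¹ • y) := by
        conv_lhs => rw [← smul_inv_smul₀ ht.ne' y]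
        rw [dist_smul₀, Real.norm_of_nonneg ht.le]
      rw [h3]
      exact mul_le_mul_of_nonneg_left h2 ht.le
    refine lt_of_lt_of_le ?_ h1
    rw [norm_smul, Real.norm_of_nonneg ht.le, mul_left_comm]
    exact mul_lt_mul_of_pos_left hq ht
  have hxU : x ∈ U := by
    refine ⟨hx0, ?_⟩
    have : δ * ‖x‖ = Metric.infDist x Γ / 2 := by
      rw [hδ]
      field_simp
    rw [this]
    exact half_lt_self hd0
  obtain ⟨K, k, hK, hk, h⟩ := exists_norm_fbi_coherentSum_le hθ φ hp hδ0
  set Λ := ‖(φ.chiEquiv : (RSpace d × RSpace d) →L[ℝ] CSpace d)‖ + 1 with hΛ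
  have hΛ0 : 0 < Λ := by positivity
  -- From `‖χ(q)‖ ≤ Λ ‖q‖` follows `ε ‖χ(q)‖ ^ (1 / θ) ≤ ε + k ‖q‖ ^ 2`; the additive `ε` is the
  -- source of the factor `Real.exp ε`.
  set ε := k / Λ ^ 2 with hε
  have hε0 : 0 < ε := by positivity
  refine ⟨φ.chiEquiv.symm ⁻¹' U, hUo.preimage φ.chiEquiv.symm.continuous, ?_, ?_, ?_, ε, hε0,
    K * Real.exp ε, by positivity, ?_⟩
  · intro t ht z hz
    rw [Set.mem_preimage, map_smul]
    exact hUc t ht _ hz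
  · intro h0
    rw [Set.mem_preimage, map_zero] at h0
    exact h0.1 rfl
  · rw [Set.mem_preimage, ← φ.chiEquiv_apply, φ.chiEquiv.symm_apply_apply]
    exact hxU
  · intro z hz
    obtain ⟨q, rfl⟩ := φ.chiEquiv.surjective z
    rw [Set.mem_preimage, φ.chiEquiv.symm_apply_apply] at hz
    have hz1 : ‖φ.chiEquiv q‖ ≤ Λ * ‖q‖ := by
      refine ((φ.chiEquiv : (RSpace d × RSpace d) →L[ℝ] CSpace d).le_opNorm q).trans ?_
      refine mul_le_mul_of_nonneg_right ?_ (norm_nonneg q)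
      linarith
    rw [φ.chiEquiv_apply] at hz1 ⊢
    refine (h q fun j => ?_).trans ?_
    · rw [norm_sub_rev, ← dist_eq_norm]
      exact hz.2.le.trans (Metric.infDist_le_dist_of_mem (hpΓ j))
    · rw [mul_assoc, ← Real.exp_add]
      refine mul_le_mul_of_nonneg_left (Real.exp_le_exp.2 ?_) hK.le
      have h1 := rpow_inv_le_one_add_sq hθ (norm_nonneg (φ.chi q))
      have h2 := pow_le_pow_left₀ (norm_nonneg _) hz1 2
      have h3 : ε * ‖φ.chi q‖ ^ (1 / θ) ≤ ε * (1 + Λ ^ 2 * ‖q‖ ^ 2) := by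
        refine mul_le_mul_of_nonneg_left ?_ hε0.le
        rw [mul_pow] at h2
        linarith
      have h4 : ε * (1 + Λ ^ 2 * ‖q‖ ^ 2) = ε + k * ‖q‖ ^ 2 := by
        rw [hε]
        field_simp
      linarith

/-- A cone `L` with decay around `χ(x)` would contain `χ(p k - r)` for infinitely many `k`, where
the lower bound `v e^Φ` contradicts a bound `o(e^Φ)`. -/
theorem subset_WF_coherentSum (hθ : 1 / 2 ≤ θ) {Γ : Set (RSpace d × RSpace d)}
    (hΓ0 : (0 : RSpace d × RSpace d) ∉ Γ) {p : ℕ → RSpace d × RSpace d} (hp : ∀ k, ‖p k‖ = 2 ^ k)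
    (hpU : ∀ U : Set (RSpace d × RSpace d), IsOpen U → IsConic U → (U ∩ Γ).Nonempty →
      ∃ b ∈ U, ∃ᶠ k in atTop, p k = (2 : ℝ) ^ k • b)
    (φ : FBIPhase d) : Γ ⊆ WF hθ φ (coherentSum θ p hp) := by
  intro x hx
  refine ⟨fun h => hΓ0 (h ▸ hx), ?_⟩
  rintro ⟨L, hLo, hLc, -, hxL, ε, hε, K, hK, hbound⟩
  set U : Set (RSpace d × RSpace d) := φ.chiEquiv ⁻¹' L with hU
  have hUo : IsOpen U := hLo.preimage φ.chiEquiv.continuous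
  have hUc : IsConic U := by
    intro t ht q hq
    rw [hU, Set.mem_preimage, map_smul]
    exact hLc t ht _ hq
  obtain ⟨b, hbU, hfreq⟩ := hpU U hUo hUc ⟨x, hxL, hx⟩
  obtain ⟨r, v, hv, hlow⟩ := exists_le_norm_fbi_coherentSum hθ φ hp
  -- When `p k = 2 ^ k • b`, the point `p k - r` is `2 ^ k` times `b - 2⁻ᵏ r`. The fixed translation
  -- by `r` thus disappears in direction, and openness of `U` at `b` suffices.
  have hmem : ∀ᶠ k : ℕ in atTop, b - ((2 : ℝ) ^ k)⁻¹ • r ∈ U := by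
    have h1 : Tendsto (fun k : ℕ => b - ((2 : ℝ) ^ k)⁻¹ • r) atTop (𝓝 b) := by
      have h2 : Tendsto (fun k : ℕ => ((2 : ℝ) ^ k)⁻¹) atTop (𝓝 0) :=
        (tendsto_pow_atTop_atTop_of_one_lt (by norm_num)).inv_tendsto_atTop
      simpa using tendsto_const_nhds.sub (h2.smul_const r)
    exact h1.eventually (hUo.mem_nhds hbU)
  have hlim : Tendsto (fun k : ℕ => K * Real.exp (-ε * ‖φ.chi (p k - r)‖ ^ (1 / θ)))
      atTop (𝓝 0) := by
    set Λ := ‖(φ.chiEquiv.symm : CSpace d →L[ℝ] (RSpace d × RSpace d))‖ + 1 with hΛ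
    have hΛ0 : 0 < Λ := by positivity
    -- Boundedness of the inverse of `χ` forces `‖χ(p k - r)‖ → ∞`, so the assumed decay factor
    -- tends to `0`.
    have h1 : ∀ k : ℕ, ((2 : ℝ) ^ k + -‖r‖) / Λ ≤ ‖φ.chi (p k - r)‖ := by
      intro k
      rw [div_le_iff₀ hΛ0]
      have h2 := (φ.chiEquiv.symm : CSpace d →L[ℝ] (RSpace d × RSpace d)).le_opNorm
        (φ.chi (p k - r))
      have h3 : (φ.chiEquiv.symm : CSpace d →L[ℝ] (RSpace d × RSpace d)) (φ.chi (p k - r)) =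
          p k - r := φ.chiEquiv.symm_apply_apply _
      rw [h3] at h2
      have h4 := norm_sub_norm_le (p k) r
      rw [hp] at h4
      have h5 := norm_nonneg (φ.chi (p k - r))
      rw [hΛ]
      linarith
    have h2 : Tendsto (fun k : ℕ => ‖φ.chi (p k - r)‖) atTop atTop :=
      tendsto_atTop_mono h1 ((tendsto_atTop_add_const_right _ _
        (tendsto_pow_atTop_atTop_of_one_lt (by norm_num))).atTop_div_const hΛ0)
    have h3 := (tendsto_rpow_atTop (by positivity : 0 < 1 / θ)).comp h2
    have h4 := Real.tendsto_exp_atBot.comp (h3.const_mul_atTop_of_neg (neg_lt_zero.2 hε))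
    simpa using h4.const_mul K
  obtain ⟨k, hpk, hlowk, hmemk, hlimk⟩ := (hfreq.and_eventually
    (hlow.and (hmem.and (hlim.eventually_lt_const hv)))).exists
  have hq : φ.chi (p k - r) ∈ L := by
    have h1 := hUc ((2 : ℝ) ^ k) (by positivity) _ hmemk
    rw [smul_sub, smul_inv_smul₀ (by positivity), ← hpk] at h1
    exact h1
  have h1 := hlowk.trans (hbound _ hq)
  rw [Real.exp_add, ← mul_assoc] at h1
  exact absurd (le_of_mul_le_mul_right h1 (Real.exp_pos _)) (not_le.2 hlimk)

/-- The zero ultradistribution. -/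
def zeroDual (θ : ℝ) (d : ℕ) : GSDual θ d where
  toLinearMap := 0
  bound _ _ := ⟨1, one_pos, fun f => by simp⟩

theorem WF_zeroDual (hθ : 1 / 2 ≤ θ) (φ : FBIPhase d) : WF hθ φ (zeroDual θ d) = ∅ := by
  rw [Set.eq_empty_iff_forall_notMem]
  rintro x ⟨hx0, hx⟩
  refine hx ⟨{0}ᶜ, isOpen_compl_singleton, fun t ht v hv => smul_ne_zero ht.ne' hv, by simp,
    fun h => hx0 (φ.chiEquiv.injective (h.trans φ.chiEquiv.map_zero.symm)), 1, one_pos, 1, one_pos,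
    fun z _ => ?_⟩
  have : fbi hθ φ (zeroDual θ d) z = 0 := mul_zero _
  rw [this, norm_zero]
  positivity

end WaveFrontSets

end GelfandShilov
end

theorem mainTheorem8 (d : ℕ) (θ : ℝ) (hθ : 1 / 2 ≤ θ) (hθ1 : θ < 1)
    (Γ : Set (GelfandShilov.RSpace d × GelfandShilov.RSpace d))
    (hΓ0 : (0 : GelfandShilov.RSpace d × GelfandShilov.RSpace d) ∉ Γ)
    (hΓclosed : IsClosed
      {p : {q : GelfandShilov.RSpace d × GelfandShilov.RSpace d // q ≠ 0} | p.1 ∈ Γ})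
    (hΓconic : GelfandShilov.IsConic Γ) :
    ∃ u : GelfandShilov.GSDual θ d,
      ∀ φ : GelfandShilov.FBIPhase d, GelfandShilov.WF hθ φ u = Γ := by
  -- An empty `Γ` offers no centres for coherent states; there the zero distribution works.
  rcases Γ.eq_empty_or_nonempty with rfl | hne
  · exact ⟨GelfandShilov.zeroDual θ d, GelfandShilov.WF_zeroDual hθ⟩
  · obtain ⟨p, hpΓ, hp, hpU⟩ := GelfandShilov.exists_sparse_sequence hΓ0 hΓconic hne
    exact ⟨GelfandShilov.coherentSum θ p hp, fun φ => Set.Subset.antisymm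
      (GelfandShilov.WF_coherentSum_subset hθ hΓ0 hne hΓclosed hΓconic hp hpΓ φ)
      (GelfandShilov.subset_WF_coherentSum hθ hΓ0 hp hpU φ)⟩
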